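/- A combinatorial 3-manifold is a finite, nonempty, pure 3-dimensional simplicial complex $M$ all of whose vertex links are combinatorial 2-spheres (with standard PL structure); it is 2-neighborly if any two of its vertices span an edge. Let $V = V_1 \,\dot\cup\, V_2$ be a partition of the vertex set of $M$. Let $f : |M| \to \mathbb{R}$ be regular simplexwise linear, i.e. injective on the vertices and linear on each simplex, with $f(v) < x_0 < f(w)$ for all $v \in V_1$, $w \in V_2$. The slicing $S = S_{(V_1,V_2)}$ is the preimage $f^{-1}(x_0)$, regarded as a polyhedral complex whose cells are its nonempty intersections with the simplices of $M$; its 2-cells are triangles and quadrilaterals. Its genus $g$ is defined by $\chi(S) = 2 - 2g$, where $\chi(S)$ is the number of vertices minus the number of edges plus the number of 2-cells of $S$ (so $g$ is the usual genus if $S$ is connected and orientable). **Theorem.** Let $M$ be a 2-neighborly combinatorial 3-manifold with $n$ vertices, let $S_{(V_1,V_2)}$ be a slicing of $M$, let $c$ be defined by $|V_1| + c = |V_2| - c$, let $g$ be the genus of $S_{(V_1,V_2)}$ and $q$ its number of quadrilaterals. Then $$q \;\ge\; 4g + \frac{3n}{2} - (4 + 2c^2).$$ For $c = 0$ this inequality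 is sharp for all values $g = \binom{n/2-1}{2}$ with $n \ge 6$ even. More precisely, let $k \ge 3$, let $C_4(2k)$ be the cyclic 4-polytope, i.e. the convex hull of the points $(t,t^2,t^3,t^4)$, $t = 1, \dots, 2k$, and label its vertices by $t = 1,\dots,2k$. Then its boundary complex is a 2-neighborly combinatorial 3-manifold with $n = 2k$ vertices, and the slicing with $V_1 = \{1,3,\dots,2k-1\}$ and $V_2 = \{2,4,\dots,2k\}$ (so $c = 0$) has genus $g = \binom{k-1}{2}$ and exactly $q = 4g + \frac{3n}{2} - 4$ quadrilaterals. -/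

import Mathlib

namespace NormalSlicing

noncomputable section

/-! ### Combinatorial spheres and combinatorial 3-manifolds -/

/-- The link of the vertex `v`: all simplices `τ` with `v ∉ τ` and `{v} ∪ τ` a face. -/
def link {α : Type*} [DecidableEq α] (K : PreAbstractSimplicialComplex α) (v : α) :
    PreAbstractSimplicialComplex α where
  faces := {τ | τ.Nonempty ∧ v ∉ τ ∧ insert v τ ∈ K.faces}
  isRelLowerSet_faces := by
    rintro τ ⟨hne, hv, hmem⟩
    refine ⟨hne, fun t hts ht => ⟨ht, fun h => hv (hts h), ?_⟩⟩
    exact (K.isRelLowerSet_faces hmem).2 (Finset.insert_subset_insert v hts)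
      (Finset.insert_nonempty v t)

/-- The stellar subdivision of `K` at the simplex `A` with new vertex `a`: the open star of `A`
is removed and replaced by the cone with apex `a` over `∂A * link A`. -/
def stellar {α : Type*} [DecidableEq α] (K : PreAbstractSimplicialComplex α)
    (A : Finset α) (a : α) : PreAbstractSimplicialComplex α where
  faces := {σ | (σ ∈ K.faces ∧ ¬ A ⊆ σ) ∨
    ∃ τ : Finset α, ¬ A ⊆ τ ∧ τ ∪ A ∈ K.faces ∧ σ = insert a τ}
  isRelLowerSet_faces := by
    rintro σ (⟨hσ, hA⟩ | ⟨τ, hA, hτ, rfl⟩)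
    · refine ⟨(K.isRelLowerSet_faces hσ).1, fun t hts ht => Or.inl ⟨?_, fun h => hA (h.trans hts)⟩⟩
      exact (K.isRelLowerSet_faces hσ).2 hts ht
    · refine ⟨Finset.insert_nonempty a τ, fun t hts ht => ?_⟩
      by_cases hat : a ∈ t
      · refine Or.inr ⟨t.erase a, ?_, ?_, (Finset.insert_erase hat).symm⟩
        · exact fun h => hA (h.trans (Finset.subset_insert_iff.mp hts))
        · refine (K.isRelLowerSet_faces hτ).2
            (Finset.union_subset_union (Finset.subset_insert_iff.mp hts) subset_rfl) ?_
          have hAne : A.Nonempty := by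
            rw [Finset.nonempty_iff_ne_empty]
            rintro rfl
            exact hA (Finset.empty_subset τ)
          exact hAne.mono Finset.subset_union_right
      · have htτ : t ⊆ τ := (Finset.subset_insert_iff_of_notMem hat).mp hts
        refine Or.inl ⟨?_, fun h => hA (h.trans htτ)⟩
        exact (K.isRelLowerSet_faces hτ).2 (htτ.trans Finset.subset_union_left) ht

/-- `L` arises from `K` by one stellar subdivision. -/
def StellarStep (K L : PreAbstractSimplicialComplex ℕ) : Prop :=
  ∃ A ∈ K.faces, ∃ a : ℕ, {a} ∉ K.faces ∧ L = stellar K A a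

/-- The boundary complex of the `(d+1)`-simplex with vertices `0, …, d + 1`. -/
def simplexBoundary (d : ℕ) : PreAbstractSimplicialComplex ℕ where
  faces := {σ | σ.Nonempty ∧ σ ⊂ Finset.range (d + 2)}
  isRelLowerSet_faces := by
    rintro σ ⟨hne, hσ⟩
    exact ⟨hne, fun t hts ht => ⟨ht, lt_of_le_of_lt hts hσ⟩⟩

/-- A combinatorial `d`-sphere (with the standard PL structure): up to renaming its vertices, the
complex can be transformed into the boundary of the `(d+1)`-simplex by a finite sequence of
stellar subdivisions and their inverses. -/
def IsCombinatorialSphere {α : Type*} (d : ℕ) (K : PreAbstractSimplicialComplex α) : Prop :=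
  ∃ φ : α → ℕ, Function.Injective φ ∧
    Relation.EqvGen StellarStep (K.map φ) (simplexBoundary d)

/-- A combinatorial 3-manifold with vertex set `V`: a (nonempty) pure 3-dimensional simplicial
complex all of whose vertex links are combinatorial 2-spheres. -/
def IsCombinatorial3Manifold {V : Type*} [DecidableEq V] (M : AbstractSimplicialComplex V) :
    Prop :=
  M.faces.Nonempty ∧
  (∀ σ ∈ M.faces, σ.card ≤ 4 ∧ ∃ τ ∈ M.faces, σ ⊆ τ ∧ τ.card = 4) ∧
  ∀ v : V, IsCombinatorialSphere 2 (link M.toPreAbstractSimplicialComplex v)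

/-- The number of faces with exactly `k` vertices. -/
def faceCount {V : Type*} (M : AbstractSimplicialComplex V) (k : ℕ) : ℕ :=
  {σ : Finset V | σ ∈ M.faces ∧ σ.card = k}.ncard

/-- `M` is `k`-neighborly: it contains all possible faces with `k` vertices. -/
def IsNeighborly {V : Type*} (k : ℕ) (M : AbstractSimplicialComplex V) : Prop :=
  faceCount M k = (faceCount M 1).choose k

/-! ### Regular simplexwise linear functions and slicings -/

/-- The geometric simplex spanned by `σ` in the standard realization in `V → ℝ`, where the vertex
`v` is the unit vector `Pi.single v 1`. -/
def geomSimplex {V : Type*} [Fintype V] (σ : Finset V) : Set (V → ℝ) :=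
  {p | p ∈ stdSimplex ℝ V ∧ ∀ v, v ∉ σ → p v = 0}

/-- The underlying polyhedron `|M|`. -/
def polyhedron {V : Type*} [Fintype V] (M : AbstractSimplicialComplex V) : Set (V → ℝ) :=
  ⋃ σ ∈ M.faces, geomSimplex σ

/-- The value of `F` at the vertex `v`. -/
def vertexValue {V : Type*} [DecidableEq V] (F : (V → ℝ) → ℝ) (v : V) : ℝ :=
  F (Pi.single v 1)

/-- `F` (only its values on `|M|` matter) is regular simplexwise linear: it takes different values
at different vertices and is (affine) linear on every simplex. -/
def IsRsl {V : Type*} [Fintype V] [DecidableEq V] (M : AbstractSimplicialComplex V)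
    (F : (V → ℝ) → ℝ) : Prop :=
  Function.Injective (vertexValue F) ∧
  ∀ σ ∈ M.faces, ∀ p ∈ geomSimplex σ, F p = ∑ v, p v * vertexValue F v

/-- `F` and the level `x` define the slicing `S_(V₁,V₂)` of `M`: `F` is an rsl-function with
`F v < x < F w` for all `v ∈ V₁`, `w ∈ V₂`. -/
def Defines {V : Type*} [Fintype V] [DecidableEq V] (M : AbstractSimplicialComplex V)
    (V₁ V₂ : Finset V) (F : (V → ℝ) → ℝ) (x : ℝ) : Prop :=
  IsRsl M F ∧ (∀ v ∈ V₁, vertexValue F v < x) ∧ ∀ w ∈ V₂, x < vertexValue F w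

/-- The slicing `F⁻¹(x)`, as a subset of `|M|`. -/
def slicing {V : Type*} [Fintype V] (M : AbstractSimplicialComplex V) (F : (V → ℝ) → ℝ) (x : ℝ) :
    Set (V → ℝ) :=
  {p | p ∈ polyhedron M ∧ F p = x}

/-- The cells of the slicing as a polyhedral complex: its nonempty intersections with the simplices
of `M`. -/
def slicingCells {V : Type*} [Fintype V] (M : AbstractSimplicialComplex V) (F : (V → ℝ) → ℝ)
    (x : ℝ) : Set (Set (V → ℝ)) :=
  {C | C.Nonempty ∧ ∃ σ ∈ M.faces, C = slicing M F x ∩ geomSimplex σ}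

/-- The dimension of a cell. -/
def cellDim {V : Type*} (C : Set (V → ℝ)) : ℕ :=
  Module.finrank ℝ (vectorSpan ℝ C)

/-- The number of cells of dimension `i`. -/
def cellCount {V : Type*} [Fintype V] (M : AbstractSimplicialComplex V) (F : (V → ℝ) → ℝ) (x : ℝ)
    (i : ℕ) : ℕ :=
  {C | C ∈ slicingCells M F x ∧ cellDim C = i}.ncard

/-- The number of quadrilaterals of the slicing: the 2-dimensional cells (convex polygons) with
exactly four vertices. -/
def quadCount {V : Type*} [Fintype V] (M : AbstractSimplicialComplex V) (F : (V → ℝ) → ℝ)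
    (x : ℝ) : ℕ :=
  {C | C ∈ slicingCells M F x ∧ cellDim C = 2 ∧ (Set.extremePoints ℝ C).ncard = 4}.ncard

/-- The Euler characteristic (vertices − edges + 2-cells) of the slicing of a 3-manifold. -/
def eulerChar {V : Type*} [Fintype V] (M : AbstractSimplicialComplex V) (F : (V → ℝ) → ℝ)
    (x : ℝ) : ℤ :=
  (cellCount M F x 0 : ℤ) - cellCount M F x 1 + cellCount M F x 2

/-- The genus `g` of the slicing, determined by `χ = 2 - 2g`. It is the usual genus if the surface
is connected and orientable; it may be a half-integer if the surface is not orientable. -/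
def genus {V : Type*} [Fintype V] (M : AbstractSimplicialComplex V) (F : (V → ℝ) → ℝ)
    (x : ℝ) : ℝ :=
  (2 - (eulerChar M F x : ℝ)) / 2

/-! ### The boundary complex of the cyclic 4-polytope -/

/-- The point `(t, t², t³, t⁴)` of the moment curve with `t = i + 1`; so `i = 0, …, m - 1`
carries the label `i + 1 ∈ {1, …, m}`. -/
def momentPoint {m : ℕ} (i : Fin m) : Fin 4 → ℝ :=
  fun j => ((i : ℕ) + 1 : ℝ) ^ ((j : ℕ) + 1)

/-- The cyclic 4-polytope `C₄(m)`. -/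
def cyclicPolytope (m : ℕ) : Set (Fin 4 → ℝ) :=
  convexHull ℝ (Set.range (momentPoint (m := m)))

/-- Every vertex of the cyclic polytope lies in a proper face. -/
theorem exists_face_of_vertex {m : ℕ} (hm : 2 ≤ m) (i : Fin m) :
    ∃ B, IsExposed ℝ (cyclicPolytope m) B ∧ B ≠ cyclicPolytope m ∧ momentPoint i ∈ B := by
  let l : StrongDual ℝ (Fin 4 → ℝ) :=
    (2 * ((i : ℕ) + 1 : ℝ)) • ContinuousLinearMap.proj (R := ℝ) (φ := fun _ : Fin 4 => ℝ) 0 -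
      ContinuousLinearMap.proj (R := ℝ) (φ := fun _ : Fin 4 => ℝ) 1
  have hl : ∀ j : Fin m, l (momentPoint j) =
      l (momentPoint i) - (((j : ℕ) : ℝ) - ((i : ℕ) : ℝ)) ^ 2 := by
    intro j
    simp only [l, momentPoint, sub_apply, smul_apply, ContinuousLinearMap.proj_apply,
      smul_eq_mul, Fin.val_zero, Fin.val_one]
    ring
  have hmem : ∀ j : Fin m, momentPoint j ∈ cyclicPolytope m :=
    fun j => subset_convexHull ℝ _ ⟨j, rfl⟩
  refine ⟨l.toExposed (cyclicPolytope m), ContinuousLinearMap.toExposed.isExposed, ?_,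
    hmem i, ?_⟩
  · intro h
    obtain ⟨j, hj⟩ : ∃ j : Fin m, j ≠ i := by
      have : Nontrivial (Fin m) := Fin.nontrivial_iff_two_le.mpr hm
      exact exists_ne i
    have h1 : momentPoint j ∈ l.toExposed (cyclicPolytope m) := h.symm.subset (hmem j)
    have h2 := h1.2 _ (hmem i)
    rw [hl j] at h2
    have h3 : ((j : ℕ) : ℝ) - ((i : ℕ) : ℝ) ≠ 0 := by
      rw [sub_ne_zero]
      exact fun h => hj (Fin.ext (by exact_mod_cast h))
    have h4 := pow_pos (abs_pos.mpr h3) 2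
    rw [sq_abs] at h4
    linarith
  · intro y hy
    have hsub : cyclicPolytope m ⊆ {z | l z ≤ l (momentPoint i)} := by
      refine convexHull_min ?_ (convex_halfSpace_le l.toLinearMap.isLinear _)
      rintro _ ⟨j, rfl⟩
      have := sq_nonneg (((j : ℕ) : ℝ) - ((i : ℕ) : ℝ))
      show l (momentPoint j) ≤ l (momentPoint i)
      rw [hl j]
      linarith
    exact hsub hy

/-- The boundary complex of `C₄(m)`: a nonempty set of vertices is a face if and only if it lies in
a proper face of the polytope. (The polytope is simplicial, so these are exactly the vertex sets of
its nonempty proper faces.) -/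
def cyclicBoundary (m : ℕ) (hm : 2 ≤ m) : AbstractSimplicialComplex (Fin m) where
  faces := {σ | σ.Nonempty ∧ ∃ B, IsExposed ℝ (cyclicPolytope m) B ∧ B ≠ cyclicPolytope m ∧
    ∀ i ∈ σ, momentPoint i ∈ B}
  isRelLowerSet_faces := by
    rintro σ ⟨hne, B, hB, hBP, hσ⟩
    exact ⟨hne, fun t hts ht => ⟨ht, B, hB, hBP, fun i hi => hσ i (hts hi)⟩⟩
  singleton_mem := by
    intro i
    obtain ⟨B, hB, hBP, hi⟩ := exists_face_of_vertex hm i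
    exact ⟨Finset.singleton_nonempty i, B, hB, hBP, by simpa using hi⟩

/-- The vertices of `C₄(m)` with odd label. -/
def oddLabels (m : ℕ) : Finset (Fin m) :=
  Finset.univ.filter fun i => Odd ((i : ℕ) + 1)

/-- The vertices of `C₄(m)` with even label. -/
def evenLabels (m : ℕ) : Finset (Fin m) :=
  Finset.univ.filter fun i => Even ((i : ℕ) + 1)

end

end NormalSlicing

open NormalSlicing

namespace NormalSlicing

set_option linter.unusedSectionVars false

/-! ### Invariants of stellar subdivision -/

/-! The cells of the slicing correspond to the mixed faces of `M`, those with vertices on both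
sides; a mixed face with `i + 2` vertices gives a cell of dimension `i`, and quadrilaterals come
from tetrahedra split 2-2. Let `T` be the number of mixed tetrahedra and `n = |V|`. Neighborliness
gives `|V₁||V₂|` mixed edges. A mixed tetrahedron has three mixed triangles, or four if it is split
2-2, and every triangle lies in two tetrahedra, so twice the number of mixed triangles is `3T + q`.
Hence `2χ = 2|V₁||V₂| - q - T` (`two_mul_eulerChar`). Bounding `T` by the number of all tetrahedra,
which is `n(n-3)/2`, and using `|V₁||V₂| = n²/4 - c²` gives the inequality. Equality holds when
every tetrahedron is mixed.

The manifold hypothesis enters through two properties of the links: they are closed surfaces, and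
they have Euler characteristic two. Both are read off the boundary of the tetrahedron and carried
along stellar moves in both directions (`invariants_of_eqvGen`). The first puts each triangle in two
tetrahedra; the second, summed over all vertices, yields the number of tetrahedra
(`card_kFaces_four`).

For the cyclic polytope, affine functionals restrict to quartics on the moment curve. Gale's
condition (`mem_cyclicBoundary_iff_isPairCovered`) follows: faces are the nonempty sets covered by
two cyclically adjacent pairs. With an even number of vertices each pair has one odd and one even
label, so every tetrahedron is split 2-2; equality holds and `q` is the number of all tetrahedra,
which determines `g`. Vertex links are boundaries of cyclic 3-polytopes, built from the tetrahedron
by repeatedly subdividing a triangle (`stackedSphere_eqvGen`). -/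

theorem mem_of_subset_face {α : Type*} {K : PreAbstractSimplicialComplex α} {σ τ : Finset α}
    (hτ : τ ∈ K.faces) (h : σ ⊆ τ) (hne : σ.Nonempty) :
    σ ∈ K.faces :=
  (K.isRelLowerSet_faces hτ).2 h hne

theorem notMem_face_of_new {α : Type*} {K : PreAbstractSimplicialComplex α} {a : α}
    (ha : {a} ∉ K.faces) {σ : Finset α} (hσ : σ ∈ K.faces) : a ∉ σ :=
  fun h => ha (mem_of_subset_face hσ (Finset.singleton_subset_iff.mpr h)
    (Finset.singleton_nonempty a))

/-- The alternating number of simplices `∑ (-1)^|σ|`. -/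
noncomputable def altSum {α : Type*} (S : Set (Finset α)) : ℤ := ∑ᶠ σ ∈ S, (-1 : ℤ) ^ σ.card

theorem altSum_union {α : Type*} {S T : Set (Finset α)}
    (h : Disjoint S T) (hS : S.Finite) (hT : T.Finite) :
    altSum (S ∪ T) = altSum S + altSum T :=
  finsum_mem_union h hS hT

section Stellar

variable {α : Type*} [DecidableEq α] {K : PreAbstractSimplicialComplex α} {A : Finset α} {a : α}

theorem mem_stellar_of_notMem {σ : Finset α} (h : a ∉ σ) :
    σ ∈ (stellar K A a).faces ↔ σ ∈ K.faces ∧ ¬ A ⊆ σ := by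
  constructor
  · rintro (h' | ⟨τ, _, _, rfl⟩)
    · exact h'
    · exact absurd (Finset.mem_insert_self a τ) h
  · exact Or.inl

theorem insert_mem_stellar (ha : {a} ∉ K.faces) {τ : Finset α} (h : a ∉ τ) :
    insert a τ ∈ (stellar K A a).faces ↔ ¬ A ⊆ τ ∧ τ ∪ A ∈ K.faces := by
  constructor
  · rintro (h' | ⟨τ', h1, h2, h3⟩)
    · exact absurd (Finset.mem_insert_self a τ) (notMem_face_of_new ha h'.1)
    · have h4 : a ∉ τ' := fun h5 => notMem_face_of_new ha h2 (Finset.mem_union_left _ h5)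
      have : τ = τ' := by
        rw [← Finset.erase_insert h, h3, Finset.erase_insert h4]
      exact this ▸ ⟨h1, h2⟩
  · exact fun h' => Or.inr ⟨τ, h'.1, h'.2, rfl⟩

/-- The vertices `v` extending the simplex `ρ` to a face of `K` with one more vertex. -/
def cofaceVertices (K : PreAbstractSimplicialComplex α) (ρ : Finset α) : Set α :=
  {v | v ∉ ρ ∧ insert v ρ ∈ K.faces}

/-- Every face has at most `d + 1` vertices, and every face with `d` vertices lies in exactly two
faces with `d + 1` vertices. -/
def IsClosedPseudomanifold (d : ℕ) (K : PreAbstractSimplicialComplex α) : Prop :=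
  (∀ σ ∈ K.faces, σ.card ≤ d + 1) ∧
    ∀ ρ ∈ K.faces, ρ.card = d → (cofaceVertices K ρ).ncard = 2

/-- If `ρ ∪ A` is not a face, nothing changes around `ρ`. Otherwise the dimension bound leaves
exactly one vertex `v₀` of `A` outside `ρ`; the coface through `v₀` contains `A` and disappears, and
the one through `a` replaces it. -/
theorem ncard_cofaceVertices_stellar {d : ℕ} (hd : ∀ σ ∈ K.faces, σ.card ≤ d + 1)
    (ha : {a} ∉ K.faces) {ρ : Finset α} (hρ : ρ ∈ K.faces) (hρd : ρ.card = d) (hA : ¬ A ⊆ ρ) :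
    (cofaceVertices (stellar K A a) ρ).ncard = (cofaceVertices K ρ).ncard := by
  have haρ := notMem_face_of_new ha hρ
  have hav : ∀ v, v ≠ a → a ∉ insert v ρ := by
    intro v hv h
    rcases Finset.mem_insert.mp h with h | h
    exacts [hv h.symm, haρ h]
  by_cases hU : ρ ∪ A ∈ K.faces
  · have h1 : (A \ ρ).card = 1 := by
      have h2 := hd _ hU
      have h3 : (ρ ∪ A).card = ρ.card + (A \ ρ).card := by
        rw [← Finset.card_union_of_disjoint Finset.disjoint_sdiff, Finset.union_sdiff_self_eq_union]
      have h4 : 0 < (A \ ρ).card := by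
        rw [Finset.card_pos, Finset.sdiff_nonempty]
        exact hA
      omega
    obtain ⟨v₀, hv₀⟩ := Finset.card_eq_one.mp h1
    have hUv : ρ ∪ A = insert v₀ ρ := by
      rw [← Finset.union_sdiff_self_eq_union, hv₀, Finset.union_comm]; rfl
    have hv₀' : v₀ ∈ A ∧ v₀ ∉ ρ := by
      have : v₀ ∈ A \ ρ := by rw [hv₀]; exact Finset.mem_singleton_self _
      simpa using this
    have hset : cofaceVertices (stellar K A a) ρ = insert a (cofaceVertices K ρ \ {v₀}) := by
      ext v
      by_cases hva : v = a
      · subst hva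
        simp [cofaceVertices, haρ, insert_mem_stellar ha haρ, hA, hU]
      · have hiff : A ⊆ insert v ρ ↔ v = v₀ := by
          constructor
          · intro h
            rcases Finset.mem_insert.mp (h hv₀'.1) with h | h
            exacts [h.symm, absurd h hv₀'.2]
          · rintro rfl
            rw [← hUv]; exact Finset.subset_union_right
        simp only [cofaceVertices, Set.mem_ofPred_eq, mem_stellar_of_notMem (hav v hva), hiff,
          Set.mem_insert_iff, hva, false_or, Set.mem_sdiff, Set.mem_singleton_iff]
        tauto
    rw [hset]
    refine Set.ncard_exchange (fun h => ?_) ⟨hv₀'.2, hUv ▸ hU⟩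
    exact notMem_face_of_new ha h.2 (Finset.mem_insert_self a ρ)
  · congr 1
    ext v
    by_cases hva : v = a
    · subst hva
      simp only [cofaceVertices, Set.mem_ofPred_eq, insert_mem_stellar ha haρ, hU, and_false,
        false_iff, not_and]
      exact fun _ h => notMem_face_of_new ha h (Finset.mem_insert_self v ρ)
    · simp only [cofaceVertices, Set.mem_ofPred_eq, mem_stellar_of_notMem (hav v hva)]
      refine and_congr_right fun _ => ⟨fun h => h.1, fun h => ⟨h, fun h' => hU ?_⟩⟩
      exact mem_of_subset_face h (Finset.union_subset (Finset.subset_insert v ρ) h')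
        ((K.isRelLowerSet_faces hρ).1.mono Finset.subset_union_left)

/-- The set `τ ∪ A` has `d` or `d + 1` vertices. In the first case the new ridge inherits the coface
vertices of the old ridge `τ ∪ A`. In the second, `A \ τ` consists of two vertices, and precisely
these extend `insert a τ`: anything else would make an old face too large, while adding one of them
still leaves the other missing. -/
theorem ncard_cofaceVertices_stellar_insert {d : ℕ} (hd : ∀ σ ∈ K.faces, σ.card ≤ d + 1)
    (ha : {a} ∉ K.faces) {τ : Finset α} (hA : ¬ A ⊆ τ) (hτ : τ ∪ A ∈ K.faces)
    (hτd : τ.card + 1 = d) :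
    (cofaceVertices (stellar K A a) (insert a τ)).ncard =
      if (τ ∪ A).card = d then (cofaceVertices K (τ ∪ A)).ncard else 2 := by
  have haU := notMem_face_of_new ha hτ
  have haτ : a ∉ τ := fun h => haU (Finset.mem_union_left _ h)
  have h3 : (τ ∪ A).card = τ.card + (A \ τ).card := by
    rw [← Finset.card_union_of_disjoint Finset.disjoint_sdiff, Finset.union_sdiff_self_eq_union]
  have h4 : 0 < (A \ τ).card := by
    rw [Finset.card_pos, Finset.sdiff_nonempty]
    exact hA
  have hmem : ∀ v, v ∈ cofaceVertices (stellar K A a) (insert a τ) ↔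
      v ≠ a ∧ v ∉ τ ∧ ¬ A ⊆ insert v τ ∧ insert v (τ ∪ A) ∈ K.faces := by
    intro v
    by_cases hva : v = a
    · simp [cofaceVertices, hva]
    · have h5 : a ∉ insert v τ := by
        simp only [Finset.mem_insert, haτ, or_false]
        exact fun h => hva h.symm
      simp only [cofaceVertices, Set.mem_ofPred_eq, Finset.insert_comm v a,
        insert_mem_stellar ha h5, Finset.insert_union]
      simp only [Finset.mem_insert, hva, false_or, ne_eq, not_false_eq_true, true_and]
  split_ifs with hc
  · have h1 : (A \ τ).card = 1 := by omega
    obtain ⟨v₁, hv₁⟩ := Finset.card_eq_one.mp h1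
    have hUv : τ ∪ A = insert v₁ τ := by
      rw [← Finset.union_sdiff_self_eq_union, hv₁, Finset.union_comm]; rfl
    have hv₁' : v₁ ∈ A ∧ v₁ ∉ τ := by
      have : v₁ ∈ A \ τ := by rw [hv₁]; exact Finset.mem_singleton_self _
      simpa using this
    congr 1
    ext v
    rw [hmem]
    have hiff : A ⊆ insert v τ ↔ v = v₁ := by
      constructor
      · intro h
        rcases Finset.mem_insert.mp (h hv₁'.1) with h | h
        exacts [h.symm, absurd h hv₁'.2]
      · rintro rfl
        rw [← hUv]; exact Finset.subset_union_right
    rw [hiff, hUv]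
    simp only [cofaceVertices, Set.mem_ofPred_eq, Finset.mem_insert, not_or]
    constructor
    · rintro ⟨_, h2, h3, h4⟩
      exact ⟨⟨h3, h2⟩, h4⟩
    · rintro ⟨⟨h3, h2⟩, h4⟩
      refine ⟨?_, h2, h3, h4⟩
      rintro rfl
      exact notMem_face_of_new ha h4 (Finset.mem_insert_self _ _)
  · have h1 : (A \ τ).card = 2 := by
      have := hd _ hτ
      omega
    have hset : cofaceVertices (stellar K A a) (insert a τ) = ((A \ τ : Finset α) : Set α) := by
      ext v
      rw [hmem, Finset.mem_coe, Finset.mem_sdiff]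
      constructor
      · rintro ⟨_, h2, _, h5⟩
        refine ⟨?_, h2⟩
        by_contra hvA
        have h6 := hd _ h5
        rw [Finset.card_insert_of_notMem (by simp [h2, hvA])] at h6
        omega
      · rintro ⟨h5, h6⟩
        have h7 : insert v (τ ∪ A) = τ ∪ A :=
          Finset.insert_eq_of_mem (Finset.mem_union_right _ h5)
        refine ⟨?_, h6, fun h => ?_, by rwa [h7]⟩
        · rintro rfl
          exact haU (Finset.mem_union_right _ h5)
        · have h8 : A \ τ ⊆ {v} := by
            intro w hw
            rw [Finset.mem_sdiff] at hw
            rcases Finset.mem_insert.mp (h hw.1) with h9 | h9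
            exacts [Finset.mem_singleton.mpr h9, absurd h9 hw.2]
          have := Finset.card_le_card h8
          rw [Finset.card_singleton] at this
          omega
    rw [hset, Set.ncard_coe_finset, h1]

theorem card_le_of_mem_stellar {d : ℕ} (hd : ∀ σ ∈ K.faces, σ.card ≤ d) :
    ∀ σ ∈ (stellar K A a).faces, σ.card ≤ d := by
  rintro σ (h | ⟨τ, h1, h2, rfl⟩)
  · exact hd σ h.1
  · have h3 : τ.card < (τ ∪ A).card := Finset.card_lt_card
      ⟨Finset.subset_union_left, fun h => h1 (Finset.subset_union_right.trans h)⟩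
    have := hd _ h2
    have := Finset.card_insert_le a τ
    omega

/-- Deleting a vertex of `A` from a face containing `A` gives a face of the new cone. -/
theorem insert_erase_mem_stellar (ha : {a} ∉ K.faces) {σ : Finset α} {x : α}
    (hσ : σ ∈ K.faces) (hA : A ⊆ σ) (hx : x ∈ A) :
    σ.erase x ∪ A = σ ∧ ¬ A ⊆ σ.erase x ∧ a ∉ σ.erase x ∧
      insert a (σ.erase x) ∈ (stellar K A a).faces := by
  have h1 : σ.erase x ∪ A = σ := by
    ext y
    simp only [Finset.mem_union, Finset.mem_erase]
    constructor
    · rintro (h | h)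
      exacts [h.2, hA h]
    · intro h
      by_cases hy : y = x
      · exact Or.inr (hy ▸ hx)
      · exact Or.inl ⟨hy, h⟩
  have h2 : ¬ A ⊆ σ.erase x := fun h => Finset.notMem_erase x σ (h hx)
  have h3 : a ∉ σ.erase x := fun h => notMem_face_of_new ha hσ (Finset.mem_of_mem_erase h)
  exact ⟨h1, h2, h3, (insert_mem_stellar ha h3).mpr ⟨h2, h1.symm ▸ hσ⟩⟩

theorem card_le_of_stellar {d : ℕ} (hA : A.Nonempty) (ha : {a} ∉ K.faces)
    (hd : ∀ σ ∈ (stellar K A a).faces, σ.card ≤ d) : ∀ σ ∈ K.faces, σ.card ≤ d := by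
  intro σ hσ
  by_cases hAσ : A ⊆ σ
  · obtain ⟨x, hx⟩ := hA
    obtain ⟨_, _, h3, h4⟩ := insert_erase_mem_stellar ha hσ hAσ hx
    have := hd _ h4
    rwa [Finset.card_insert_of_notMem h3, Finset.card_erase_add_one (hAσ hx)] at this
  · exact hd σ (Or.inl ⟨hσ, hAσ⟩)

/-- Both directions are needed because stellar equivalence also uses inverse subdivisions. To
recover the condition at a destroyed ridge `ρ ⊇ A`, swap a vertex `x ∈ A` for `a`: this new ridge
has the same coface vertices as `ρ`. -/
theorem isClosedPseudomanifold_stellar_iff {d : ℕ} (hA : A.Nonempty) (ha : {a} ∉ K.faces) :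
    IsClosedPseudomanifold d (stellar K A a) ↔ IsClosedPseudomanifold d K := by
  constructor
  · rintro ⟨h1, h2⟩
    have hd := card_le_of_stellar hA ha h1
    refine ⟨hd, fun ρ hρ hρd => ?_⟩
    by_cases hAρ : A ⊆ ρ
    · obtain ⟨x, hx⟩ := hA
      obtain ⟨h3, h4, h5, h6⟩ := insert_erase_mem_stellar ha hρ hAρ hx
      have h7 : (ρ.erase x).card + 1 = d := by rw [Finset.card_erase_add_one (hAρ hx), hρd]
      have h8 := ncard_cofaceVertices_stellar_insert hd ha h4 (h3.symm ▸ hρ) h7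
      rw [h3, if_pos hρd] at h8
      rw [← h8]
      exact h2 _ h6 (by rw [Finset.card_insert_of_notMem h5, h7])
    · rw [← ncard_cofaceVertices_stellar hd ha hρ hρd hAρ]
      exact h2 ρ (Or.inl ⟨hρ, hAρ⟩) hρd
  · rintro ⟨h1, h2⟩
    refine ⟨card_le_of_mem_stellar h1, ?_⟩
    rintro ρ (⟨hρ, hAρ⟩ | ⟨τ, hAτ, hτ, rfl⟩) hρd
    · rw [ncard_cofaceVertices_stellar h1 ha hρ hρd hAρ]
      exact h2 ρ hρ hρd
    · have haτ : a ∉ τ := fun h => notMem_face_of_new ha hτ (Finset.mem_union_left _ h)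
      rw [Finset.card_insert_of_notMem haτ] at hρd
      rw [ncard_cofaceVertices_stellar_insert h1 ha hAτ hτ hρd]
      split_ifs with h
      · exact h2 _ hτ h
      · rfl

theorem finite_setOf_union_mem (h : K.faces.Finite) (A : Finset α) :
    {τ : Finset α | τ ∪ A ∈ K.faces}.Finite := by
  refine (h.biUnion fun σ _ => (σ.powerset : Set (Finset α)).toFinite).subset fun τ hτ => ?_
  simp only [Set.mem_iUnion]
  exact ⟨τ ∪ A, hτ, Finset.mem_coe.mpr (Finset.mem_powerset.mpr Finset.subset_union_left)⟩

theorem stellar_faces_eq : (stellar K A a).faces = {σ | σ ∈ K.faces ∧ ¬ A ⊆ σ} ∪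
    insert a '' {τ | ¬ A ⊆ τ ∧ τ ∪ A ∈ K.faces} := by
  ext σ
  constructor
  · rintro (h | ⟨τ, h1, h2, rfl⟩)
    exacts [Or.inl h, Or.inr ⟨τ, ⟨h1, h2⟩, rfl⟩]
  · rintro (h | ⟨τ, ⟨h1, h2⟩, rfl⟩)
    exacts [Or.inl h, Or.inr ⟨τ, h1, h2, rfl⟩]

theorem finite_stellar_iff (hA : A.Nonempty) (ha : {a} ∉ K.faces) :
    (stellar K A a).faces.Finite ↔ K.faces.Finite := by
  constructor
  · intro h
    obtain ⟨x, hx⟩ := hA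
    -- Swapping a fixed vertex of `A` for `a` embeds the removed faces into the new ones.
    have h1 : {σ | σ ∈ K.faces ∧ A ⊆ σ}.Finite := by
      refine Set.Finite.of_injOn (f := fun σ => insert a (σ.erase x))
        (fun σ hσ => (insert_erase_mem_stellar ha hσ.1 hσ.2 hx).2.2.2) ?_ h
      intro σ hσ τ hτ hστ
      have h2 := (insert_erase_mem_stellar ha hσ.1 hσ.2 hx).2.2.1
      have h3 := (insert_erase_mem_stellar ha hτ.1 hτ.2 hx).2.2.1
      have h4 : σ.erase x = τ.erase x := by
        rw [← Finset.erase_insert h2, ← Finset.erase_insert h3]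
        exact congrArg (fun s => Finset.erase s a) hστ
      rw [← Finset.insert_erase (hσ.2 hx), h4, Finset.insert_erase (hτ.2 hx)]
    refine (h.union h1).subset fun σ hσ => ?_
    by_cases h2 : A ⊆ σ
    exacts [Or.inr ⟨hσ, h2⟩, Or.inl (Or.inl ⟨hσ, h2⟩)]
  · intro h
    rw [stellar_faces_eq]
    exact (h.subset fun σ hσ => hσ.1).union
      (((finite_setOf_union_mem h A).subset fun τ hτ => hτ.2).image _)

/-- Toggling a fixed `x ∈ A` leaves `τ ∪ A` unchanged and reverses the sign. The empty `τ` belongs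
to this set. -/
theorem altSum_setOf_union_mem (h : K.faces.Finite) (hA : A.Nonempty) :
    altSum {τ : Finset α | τ ∪ A ∈ K.faces} = 0 := by
  obtain ⟨x, hx⟩ := hA
  rw [altSum, finsum_mem_eq_finite_toFinset_sum _ (finite_setOf_union_mem h A)]
  have hins : ∀ τ : Finset α, insert x τ ∪ A = τ ∪ A := fun τ => by
    rw [Finset.insert_union, Finset.insert_eq_of_mem (Finset.mem_union_right _ hx)]
  have hera : ∀ τ : Finset α, τ.erase x ∪ A = τ ∪ A := fun τ => by
    by_cases hxτ : x ∈ τ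
    · rw [← hins (τ.erase x), Finset.insert_erase hxτ]
    · rw [Finset.erase_eq_of_notMem hxτ]
  refine Finset.sum_involution (fun τ _ => if x ∈ τ then τ.erase x else insert x τ) ?_ ?_ ?_ ?_
  · intro τ _
    split_ifs with hxτ
    · rw [← Finset.card_erase_add_one hxτ, pow_succ]; ring
    · rw [Finset.card_insert_of_notMem hxτ, pow_succ]; ring
  · intro τ _ _
    split_ifs with hxτ
    · exact fun h => Finset.notMem_erase x τ (h.symm ▸ hxτ)
    · exact fun h => hxτ (h ▸ Finset.mem_insert_self x τ)
  · intro τ hτ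
    rw [Set.Finite.mem_toFinset, Set.mem_ofPred_eq] at hτ ⊢
    split_ifs with hxτ
    · rwa [hera]
    · rwa [hins]
  · intro τ _
    by_cases hxτ : x ∈ τ
    · simp [hxτ]
    · simp [hxτ]

/-- The removed faces (those containing `A`) and the bases of the new cone together form `{τ | τ ∪ A
∈ K.faces}`, whose sum is zero. Coning with `a` flips the sign of the bases, so the new faces
contribute exactly what the removed ones did. -/
theorem altSum_stellar (h : K.faces.Finite) (hA : A.Nonempty) (ha : {a} ∉ K.faces) :
    altSum (stellar K A a).faces = altSum K.faces := by
  have hS := finite_setOf_union_mem h A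
  have hN : {τ | ¬ A ⊆ τ ∧ τ ∪ A ∈ K.faces}.Finite := hS.subset fun τ hτ => hτ.2
  have hC : {σ | σ ∈ K.faces ∧ A ⊆ σ}.Finite := h.subset fun τ hτ => hτ.1
  have hD : {σ | σ ∈ K.faces ∧ ¬ A ⊆ σ}.Finite := h.subset fun τ hτ => hτ.1
  have haN : ∀ τ ∈ {τ | ¬ A ⊆ τ ∧ τ ∪ A ∈ K.faces}, a ∉ τ := fun τ hτ h =>
    notMem_face_of_new ha hτ.2 (Finset.mem_union_left _ h)
  have e1 : altSum K.faces = altSum {σ | σ ∈ K.faces ∧ ¬ A ⊆ σ} +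
      altSum {σ | σ ∈ K.faces ∧ A ⊆ σ} := by
    rw [← altSum_union ?_ hD hC]
    · congr 1
      ext σ
      simp only [Set.mem_union, Set.mem_ofPred_eq]
      tauto
    · exact Set.disjoint_left.mpr fun σ h1 h2 => h1.2 h2.2
  have e2 : altSum {τ | τ ∪ A ∈ K.faces} = altSum {τ | ¬ A ⊆ τ ∧ τ ∪ A ∈ K.faces} +
      altSum {σ | σ ∈ K.faces ∧ A ⊆ σ} := by
    rw [← altSum_union ?_ hN hC]
    · congr 1
      ext σ
      simp only [Set.mem_union, Set.mem_ofPred_eq]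
      by_cases hAσ : A ⊆ σ
      · simp [hAσ, Finset.union_eq_left.mpr hAσ]
      · simp [hAσ]
    · exact Set.disjoint_left.mpr fun σ h1 h2 => h1.1 h2.2
  have e3 : altSum (stellar K A a).faces = altSum {σ | σ ∈ K.faces ∧ ¬ A ⊆ σ} -
      altSum {τ | ¬ A ⊆ τ ∧ τ ∪ A ∈ K.faces} := by
    rw [stellar_faces_eq, altSum, finsum_mem_union ?_ hD (hN.image _), finsum_mem_image ?_]
    · rw [sub_eq_add_neg, altSum, altSum, ← finsum_mem_neg_distrib _ hN]
      congr 1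
      refine finsum_mem_congr rfl fun τ hτ => ?_
      rw [Finset.card_insert_of_notMem (haN τ hτ), pow_succ]; ring
    · intro σ hσ τ hτ hστ
      rw [← Finset.erase_insert (haN σ hσ), hστ, Finset.erase_insert (haN τ hτ)]
    · refine Set.disjoint_left.mpr ?_
      rintro σ h1 ⟨τ, _, rfl⟩
      exact notMem_face_of_new ha h1.1 (Finset.mem_insert_self a τ)
  have e4 := altSum_setOf_union_mem h hA
  linarith

end Stellar

theorem isClosedPseudomanifold_simplexBoundary (d : ℕ) :
    IsClosedPseudomanifold d (simplexBoundary d) := by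
  refine ⟨fun σ hσ => ?_, fun ρ hρ hρd => ?_⟩
  · have := Finset.card_lt_card hσ.2
    rw [Finset.card_range] at this
    omega
  · have : cofaceVertices (simplexBoundary d) ρ =
        ((Finset.range (d + 2) \ ρ : Finset ℕ) : Set ℕ) := by
      ext v
      simp only [cofaceVertices, simplexBoundary, Set.mem_ofPred_eq, Finset.mem_coe,
        Finset.mem_sdiff]
      constructor
      · exact fun h => ⟨h.2.2.1 (Finset.mem_insert_self v ρ), h.1⟩
      · intro h
        refine ⟨h.2, Finset.insert_nonempty v ρ, Finset.ssubset_iff_subset_ne.mpr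
          ⟨Finset.insert_subset h.1 hρ.2.1, fun he => ?_⟩⟩
        have := congrArg Finset.card he
        rw [Finset.card_insert_of_notMem h.2, Finset.card_range] at this
        omega
    rw [this, Set.ncard_coe_finset, Finset.card_sdiff_of_subset hρ.2.1, Finset.card_range]
    omega

/-- Vertices carry the sign `-1`, so `altSum` is minus the Euler characteristic: `-4 + 6 - 4`. -/
theorem altSum_simplexBoundary_two : altSum (simplexBoundary 2).faces = -2 := by
  have h : (simplexBoundary 2).faces =
      (((Finset.range 4).powerset.filter fun σ => σ.Nonempty ∧ σ ≠ Finset.range 4 :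
        Finset (Finset ℕ)) : Set (Finset ℕ)) := by
    ext σ
    simp only [simplexBoundary, Set.mem_ofPred_eq, Finset.coe_filter, Finset.mem_powerset,
      Finset.ssubset_iff_subset_ne]
    tauto
  rw [altSum, h, finsum_mem_coe_finset]
  decide

/-- Combinatorial 2-spheres are finite closed surfaces with Euler characteristic two. -/
theorem invariants_of_eqvGen {K : PreAbstractSimplicialComplex ℕ}
    (h : Relation.EqvGen StellarStep K (simplexBoundary 2)) :
    IsClosedPseudomanifold 2 K ∧ altSum K.faces = -2 := by
  -- Finiteness must be transported as well: intermediate complexes are not assumed finite, and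
  -- `altSum` is meaningful only for finite ones.
  have key : ∀ K L, Relation.EqvGen StellarStep K L → (K.faces.Finite ↔ L.faces.Finite) ∧
      (K.faces.Finite → altSum K.faces = altSum L.faces) ∧
      (IsClosedPseudomanifold 2 K ↔ IsClosedPseudomanifold 2 L) := by
    intro K L h
    induction h with
    | rel K L h =>
      obtain ⟨A, hA, a, ha, rfl⟩ := h
      have hA' := (K.isRelLowerSet_faces hA).1
      exact ⟨(finite_stellar_iff hA' ha).symm, fun h => (altSum_stellar h hA' ha).symm,
        (isClosedPseudomanifold_stellar_iff hA' ha).symm⟩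
    | refl K => exact ⟨Iff.rfl, fun _ => rfl, Iff.rfl⟩
    | symm K L _ ih => exact ⟨ih.1.symm, fun h => (ih.2.1 (ih.1.mpr h)).symm, ih.2.2.symm⟩
    | trans K L N _ _ ih1 ih2 =>
      exact ⟨ih1.1.trans ih2.1, fun h => (ih1.2.1 h).trans (ih2.2.1 (ih1.1.mp h)),
        ih1.2.2.trans ih2.2.2⟩
  obtain ⟨h1, h2, h3⟩ := key _ _ h
  have hfin : (simplexBoundary 2).faces.Finite :=
    (Finset.finite_toSet (Finset.range 4).powerset).subset fun σ hσ =>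
      Finset.mem_coe.mpr (Finset.mem_powerset.mpr hσ.2.1)
  exact ⟨h3.mpr (isClosedPseudomanifold_simplexBoundary 2),
    (h2 (h1.mpr hfin)).trans altSum_simplexBoundary_two⟩

/-! ### Level sets of linear functions on simplices -/

section EdgePoint

variable {V : Type*} [DecidableEq V] {w : V → ℝ} {a b : V}

/-- The point at which the linear function with vertex values `w` vanishes on the edge `ab`. -/
noncomputable def edgePoint (w : V → ℝ) (a b : V) : V → ℝ :=
  Pi.single a (w b / (w b - w a)) + Pi.single b (-w a / (w b - w a))

theorem edgePoint_apply_of_ne {v : V} (h1 : v ≠ a) (h2 : v ≠ b) : edgePoint w a b v = 0 := by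
  simp [edgePoint, h1, h2]

theorem edgePoint_left (h : a ≠ b) : edgePoint w a b a = w b / (w b - w a) := by
  simp [edgePoint, h]

theorem edgePoint_right (h : a ≠ b) : edgePoint w a b b = -w a / (w b - w a) := by
  simp [edgePoint, h.symm]

end EdgePoint

section LevelCell

variable {V : Type*} [Fintype V] {w : V → ℝ} {σ : Finset V} {a b : V}

/-- The points of the simplex `σ` at which the linear function with vertex values `w` vanishes. -/
def levelCell (w : V → ℝ) (σ : Finset V) : Set (V → ℝ) :=
  {p | p ∈ geomSimplex σ ∧ ∑ v, p v * w v = 0}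

theorem mem_levelCell {p : V → ℝ} : p ∈ levelCell w σ ↔
    (∀ v, 0 ≤ p v) ∧ ∑ v, p v = 1 ∧ (∀ v, v ∉ σ → p v = 0) ∧ ∑ v, p v * w v = 0 := by
  simp only [levelCell, geomSimplex, stdSimplex, Set.mem_ofPred_eq, and_assoc]

/-- The level set of a simplex with vertices on both sides has a point in the interior. -/
theorem exists_pos_mem_levelCell [DecidableEq V] (ha : a ∈ σ) (hwa : w a < 0) (hb : b ∈ σ)
    (hwb : 0 < w b) : ∃ p ∈ levelCell w σ, ∀ v ∈ σ, 0 < p v := by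
  set N := ∑ v ∈ σ.filter (fun v => w v < 0), -w v with hN
  set P := ∑ v ∈ σ.filter (fun v => ¬ w v < 0), w v with hP
  have hNpos : 0 < N := Finset.sum_pos
    (fun v hv => by linarith [(Finset.mem_filter.mp hv).2]) ⟨a, by simp [ha, hwa]⟩
  have hPpos : 0 < P := Finset.sum_pos'
    (fun v hv => by linarith [(Finset.mem_filter.mp hv).2])
    ⟨b, by simp [hb, hwb.le], hwb⟩
  -- Each negative vertex gets the total positive weight `P` and each other vertex the total
  -- negative weight `N`, so the two sides contribute `-PN` and `NP`. Dividing by the coordinate sum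
  -- then normalizes.
  let p : V → ℝ := fun v => if v ∈ σ then (if w v < 0 then P else N) else 0
  have hp : ∀ v ∈ σ, 0 < p v := by
    intro v hv
    simp only [p, hv, if_true]
    split_ifs <;> assumption
  have hp0 : ∀ v, v ∉ σ → p v = 0 := fun v hv => by simp [p, hv]
  have hpn : ∀ v, 0 ≤ p v := fun v => by
    by_cases hv : v ∈ σ
    exacts [(hp v hv).le, (hp0 v hv).ge]
  have hS : 0 < ∑ v, p v := Finset.sum_pos' (fun v _ => hpn v) ⟨a, Finset.mem_univ a, hp a ha⟩
  have hw : ∑ v, p v * w v = 0 := by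
    have h1 : ∑ v, p v * w v = ∑ v ∈ σ, p v * w v :=
      (Finset.sum_subset (Finset.subset_univ σ) fun v _ hv => by rw [hp0 v hv, zero_mul]).symm
    rw [h1, ← Finset.sum_filter_add_sum_filter_not σ (fun v => w v < 0)]
    have h2 : ∑ v ∈ σ.filter (fun v => w v < 0), p v * w v = - (P * N) := by
      rw [hN, Finset.mul_sum, ← Finset.sum_neg_distrib]
      refine Finset.sum_congr rfl fun v hv => ?_
      rw [Finset.mem_filter] at hv
      simp [p, hv.1, hv.2]
    have h3 : ∑ v ∈ σ.filter (fun v => ¬ w v < 0), p v * w v = N * P := by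
      rw [hP, Finset.mul_sum]
      refine Finset.sum_congr rfl fun v hv => ?_
      rw [Finset.mem_filter] at hv
      simp only [p, hv.1, hv.2, if_true, if_false]
    rw [h2, h3]; ring
  refine ⟨fun v => p v / ∑ v, p v, mem_levelCell.mpr ⟨fun v => div_nonneg (hpn v) hS.le, ?_,
    fun v hv => by simp [hp0 v hv], ?_⟩, fun v hv => div_pos (hp v hv) hS⟩
  · rw [← Finset.sum_div, div_self hS.ne']
  · simp_rw [div_mul_eq_mul_div]
    rw [← Finset.sum_div, hw, zero_div]

/-- The linear map whose kernel is the direction of the level set. -/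
def levelMap (w : V → ℝ) (σ : Finset V) : (V → ℝ) →ₗ[ℝ] ℝ × ℝ × ({v // v ∉ σ} → ℝ) where
  toFun u := (∑ v, u v, ∑ v, u v * w v, fun v => u v)
  map_add' u u' := by
    simp only [Pi.add_apply, add_mul, Finset.sum_add_distrib]
    rfl
  map_smul' c u := by
    simp only [Pi.smul_apply, smul_eq_mul, mul_assoc, ← Finset.mul_sum]
    rfl

theorem mem_ker_levelMap {u : V → ℝ} : u ∈ LinearMap.ker (levelMap w σ) ↔
    ∑ v, u v = 0 ∧ ∑ v, u v * w v = 0 ∧ ∀ v, v ∉ σ → u v = 0 := by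
  rw [LinearMap.mem_ker]
  simp only [levelMap, LinearMap.coe_mk, AddHom.coe_mk, Prod.mk_eq_zero, funext_iff,
    Pi.zero_apply, Subtype.forall]

theorem finrank_ker_levelMap [DecidableEq V] (ha : a ∈ σ) (hb : b ∈ σ) (hab : w a ≠ w b) :
    Module.finrank ℝ (LinearMap.ker (levelMap w σ)) = σ.card - 2 := by
  have hne : w b - w a ≠ 0 := sub_ne_zero.mpr hab.symm
  have hane : a ≠ b := fun h => hab (congrArg w h)
  have hsurj : Function.Surjective (levelMap w σ) := by
    rintro ⟨s, t, h⟩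
    let u₀ : V → ℝ := fun v => if hv : v ∉ σ then h ⟨v, hv⟩ else 0
    set s' := s - ∑ v, u₀ v with hs'
    set t' := t - ∑ v, u₀ v * w v with ht'
    set β := (t' - s' * w a) / (w b - w a) with hβ
    -- Off `σ` the coordinates are prescribed; the entries at `a` and `b` then solve the 2×2 system
    -- for the two sums, which is regular since `w a ≠ w b`.
    refine ⟨u₀ + Pi.single a (s' - β) + Pi.single b β, ?_⟩
    simp only [levelMap, LinearMap.coe_mk, AddHom.coe_mk, Prod.mk.injEq, Pi.add_apply, add_mul,
      Finset.sum_add_distrib, Pi.single_apply, ite_mul, zero_mul, Finset.sum_ite_eq',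
      Finset.mem_univ, if_true]
    refine ⟨by rw [hs']; ring, ?_, ?_⟩
    · have h1 : β * (w b - w a) = t' - s' * w a := div_mul_cancel₀ _ hne
      linear_combination h1 + ht'
    · funext ⟨v, hv⟩
      have h1 : v ≠ a := fun h => hv (h ▸ ha)
      have h2 : v ≠ b := fun h => hv (h ▸ hb)
      simp [u₀, hv, h1, h2]
  have h1 := LinearMap.finrank_range_add_finrank_ker (levelMap w σ)
  rw [LinearMap.range_eq_top.mpr hsurj, finrank_top] at h1
  simp only [Module.finrank_prod, Module.finrank_self, Module.finrank_fintype_fun_eq_card] at h1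
  have h2 : Fintype.card {v // v ∉ σ} = Fintype.card V - σ.card := by
    rw [Fintype.card_subtype_compl, Fintype.card_coe]
  have h3 := Finset.card_le_univ σ
  have h4 : 2 ≤ σ.card := by
    rw [← Finset.card_pair hane]
    exact Finset.card_le_card (Finset.insert_subset ha (Finset.singleton_subset_iff.mpr hb))
  omega

/-- A point of the cell that is positive on all of `σ` can be moved slightly in any direction of the
kernel without leaving the cell. -/
theorem vectorSpan_levelCell [DecidableEq V] (ha : a ∈ σ) (hwa : w a < 0) (hb : b ∈ σ)
    (hwb : 0 < w b) : vectorSpan ℝ (levelCell w σ) = LinearMap.ker (levelMap w σ) := by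
  apply le_antisymm
  · rw [vectorSpan, Submodule.span_le]
    rintro _ ⟨p, hp, q, hq, rfl⟩
    rw [mem_levelCell] at hp hq
    rw [SetLike.mem_coe, mem_ker_levelMap]
    simp only [vsub_eq_sub, Pi.sub_apply, sub_mul, Finset.sum_sub_distrib]
    refine ⟨by linarith, by linarith, fun v hv => by rw [hp.2.2.1 v hv, hq.2.2.1 v hv, sub_zero]⟩
  · intro u hu
    rw [mem_ker_levelMap] at hu
    obtain ⟨p, hp, hpos⟩ := exists_pos_mem_levelCell ha hwa hb hwb
    have hp' := mem_levelCell.mp hp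
    have hev : ∀ᶠ ε in nhdsWithin (0 : ℝ) (Set.Ioi 0), ∀ v, 0 ≤ p v + ε * u v := by
      rw [Filter.eventually_all]
      intro v
      by_cases hv : v ∈ σ
      · have hc : Filter.Tendsto (fun ε : ℝ => p v + ε * u v) (nhdsWithin 0 (Set.Ioi 0))
            (nhds (p v + 0 * u v)) :=
          ((continuous_const.add (continuous_id.mul continuous_const)).tendsto
            (0 : ℝ)).mono_left nhdsWithin_le_nhds
        rw [zero_mul, add_zero] at hc
        exact (hc.eventually (lt_mem_nhds (hpos v hv))).mono fun _ h => le_of_lt h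
      · exact Filter.Eventually.of_forall fun ε => by
          rw [hp'.2.2.1 v hv, hu.2.2 v hv, mul_zero, add_zero]
    obtain ⟨ε, hε, hε0⟩ := (hev.and self_mem_nhdsWithin).exists
    have hq : p + ε • u ∈ levelCell w σ := by
      rw [mem_levelCell]
      simp only [Pi.add_apply, Pi.smul_apply, smul_eq_mul, add_mul, mul_assoc,
        Finset.sum_add_distrib, ← Finset.mul_sum, hu.1, hu.2.1, hp'.2.1, hp'.2.2.2, mul_zero,
        add_zero, true_and, and_true]
      exact ⟨hε, fun v hv => by rw [hp'.2.2.1 v hv, hu.2.2 v hv, mul_zero, add_zero]⟩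
    have h1 := vsub_mem_vectorSpan ℝ hq hp
    rw [vsub_eq_sub, add_sub_cancel_left] at h1
    exact (Submodule.smul_mem_iff _ (ne_of_gt hε0)).mp h1

theorem cellDim_levelCell [DecidableEq V] (ha : a ∈ σ) (hwa : w a < 0) (hb : b ∈ σ)
    (hwb : 0 < w b) : cellDim (levelCell w σ) = σ.card - 2 := by
  rw [cellDim, vectorSpan_levelCell ha hwa hb hwb,
    finrank_ker_levelMap ha hb (hwa.trans hwb).ne]

section EdgePoint

variable [DecidableEq V]

theorem edgePoint_mem (ha : a ∈ σ) (hwa : w a < 0) (hb : b ∈ σ) (hwb : 0 < w b) :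
    edgePoint w a b ∈ levelCell w σ := by
  have hpos : 0 < w b - w a := by linarith
  rw [mem_levelCell]
  refine ⟨fun v => ?_, ?_, fun v hv => edgePoint_apply_of_ne (fun h => hv (h ▸ ha))
    (fun h => hv (h ▸ hb)), ?_⟩
  · simp only [edgePoint, Pi.add_apply, Pi.single_apply]
    refine add_nonneg ?_ ?_ <;> split_ifs <;>
      first | exact le_rfl | exact div_nonneg (by linarith) hpos.le
  · simp only [edgePoint, Pi.add_apply, Pi.single_apply, Finset.sum_add_distrib,
      Finset.sum_ite_eq', Finset.mem_univ, if_true]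
    field_simp
    ring
  · simp only [edgePoint, Pi.add_apply, Pi.single_apply, Finset.sum_add_distrib, add_mul, ite_mul,
      zero_mul, Finset.sum_ite_eq', Finset.mem_univ, if_true]
    field_simp
    ring

theorem eq_edgePoint {p : V → ℝ} (hab : w a < w b) (hsupp : ∀ v, v ≠ a → v ≠ b → p v = 0)
    (h1 : ∑ v, p v = 1) (h2 : ∑ v, p v * w v = 0) : p = edgePoint w a b := by
  have hne : a ≠ b := fun h => hab.ne (congrArg w h)
  have hpos : 0 < w b - w a := by linarith
  have hsum : ∀ f : V → ℝ, (∀ v, v ≠ a → v ≠ b → f v = 0) → ∑ v, f v = f a + f b := by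
    intro f hf
    rw [← Finset.sum_pair hne]
    refine (Finset.sum_subset (Finset.subset_univ _) fun v _ hv => ?_).symm
    simp only [Finset.mem_insert, Finset.mem_singleton, not_or] at hv
    exact hf v hv.1 hv.2
  rw [hsum p hsupp] at h1
  rw [hsum _ fun v ha hb => by rw [hsupp v ha hb, zero_mul]] at h2
  funext v
  by_cases hva : v = a
  · subst hva
    rw [edgePoint_left hne, eq_div_iff hpos.ne']
    linear_combination w b * h1 - h2
  · by_cases hvb : v = b
    · subst hvb
      rw [edgePoint_right hne, eq_div_iff hpos.ne']
      linear_combination -w a * h1 + h2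
    · rw [edgePoint_apply_of_ne hva hvb, hsupp v hva hvb]

/-- A point of the cell puts positive weight on some negative `a` and some positive `b`. Splitting
off a multiple of the edge point of `ab` writes it as a proper convex combination within the cell,
so an extreme point equals that edge point. Conversely, if an edge point lies inside a segment of
the cell, nonnegativity confines the endpoints to the same edge, which meets the level set only
once. -/
theorem extremePoints_levelCell (hw : ∀ v ∈ σ, w v ≠ 0) :
    Set.extremePoints ℝ (levelCell w σ) = (fun e : V × V => edgePoint w e.1 e.2) ''
      ((σ.filter (fun v => w v < 0) ×ˢ σ.filter (fun v => 0 < w v) : Finset (V × V)) :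
        Set (V × V)) := by
  ext p
  simp only [Set.mem_image, Finset.mem_coe, Finset.mem_product, Finset.mem_filter, Prod.exists]
  constructor
  · intro hp
    have hp' := mem_levelCell.mp hp.1
    obtain ⟨hn, hs, hσ, hw0⟩ := hp'
    have hsup : ∀ v, 0 < p v → v ∈ σ := fun v hv => by
      by_contra h
      exact hv.ne' (hσ v h)
    have hexists : ∃ v, 0 < p v := by
      by_contra! h
      have : ∑ v, p v ≤ 0 := Finset.sum_nonpos fun v _ => h v
      linarith
    have hA : ∃ a, 0 < p a ∧ w a < 0 := by
      by_contra! h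
      have h1 : ∀ v ∈ Finset.univ, 0 ≤ p v * w v := fun v _ => by
        rcases (hn v).eq_or_lt with h2 | h2
        · rw [← h2, zero_mul]
        · exact mul_nonneg h2.le (h v h2)
      obtain ⟨v, hv⟩ := hexists
      have h2 := (Finset.sum_eq_zero_iff_of_nonneg h1).mp hw0 v (Finset.mem_univ v)
      rcases mul_eq_zero.mp h2 with h3 | h3
      exacts [hv.ne' h3, hw v (hsup v hv) h3]
    have hB : ∃ b, 0 < p b ∧ 0 < w b := by
      by_contra! h
      have h1 : ∀ v ∈ Finset.univ, p v * w v ≤ 0 := fun v _ => by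
        rcases (hn v).eq_or_lt with h2 | h2
        · rw [← h2, zero_mul]
        · exact mul_nonpos_of_nonneg_of_nonpos h2.le (h v h2)
      obtain ⟨v, hv⟩ := hexists
      have h2 := (Finset.sum_eq_zero_iff_of_nonpos h1).mp hw0 v (Finset.mem_univ v)
      rcases mul_eq_zero.mp h2 with h3 | h3
      exacts [hv.ne' h3, hw v (hsup v hv) h3]
    obtain ⟨a, hpa, hwa⟩ := hA
    obtain ⟨b, hpb, hwb⟩ := hB
    have ha := hsup a hpa
    have hb := hsup b hpb
    have hne : a ≠ b := fun h => (hwa.trans hwb).ne (congrArg w h)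
    refine ⟨a, b, ⟨⟨ha, hwa⟩, hb, hwb⟩, ?_⟩
    have he := edgePoint_mem (w := w) ha hwa hb hwb
    obtain ⟨en, es, eσ, ew⟩ := mem_levelCell.mp he
    have eone : ∀ v, edgePoint w a b v ≤ 1 := fun v => by
      rw [← es]
      exact Finset.single_le_sum (fun v _ => en v) (Finset.mem_univ v)
    set e := edgePoint w a b with hedef
    have hab : p a + p b ≤ 1 := by
      rw [← hs, ← Finset.sum_pair hne]
      exact Finset.sum_le_sum_of_subset_of_nonneg (Finset.subset_univ _) fun v _ _ => hn v
    -- The coordinates of `e` are at most one and supported on `a`, `b`, so `p - μ • e` stays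
    -- nonnegative; `μ < 1` because `p a` and `p b` are positive with sum at most one.
    set μ := min (p a) (p b) with hμ
    have hμ0 : 0 < μ := lt_min hpa hpb
    have hμa : μ ≤ p a := min_le_left _ _
    have hμb : μ ≤ p b := min_le_right _ _
    have hμ1 : 0 < 1 - μ := by linarith
    have hμe : ∀ v, μ * e v ≤ p v := by
      intro v
      by_cases hva : v = a
      · subst hva
        exact (mul_le_of_le_one_right hμ0.le (eone v)).trans hμa
      · by_cases hvb : v = b
        · subst hvb
          exact (mul_le_of_le_one_right hμ0.le (eone v)).trans hμb
        · rw [hedef, edgePoint_apply_of_ne hva hvb, mul_zero]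
          exact hn v
    have hq : (1 - μ)⁻¹ • (p - μ • e) ∈ levelCell w σ := by
      rw [mem_levelCell]
      simp only [Pi.smul_apply, Pi.sub_apply, smul_eq_mul, mul_assoc, ← Finset.mul_sum, sub_mul,
        Finset.sum_sub_distrib, hs, es, hw0, ew]
      refine ⟨fun v => mul_nonneg (inv_nonneg.mpr hμ1.le) (by linarith [hμe v]), ?_,
        fun v hv => by rw [hσ v hv, eσ v hv]; simp, by simp⟩
      rw [mul_one, inv_mul_cancel₀ hμ1.ne']
    refine hp.2 he hq ⟨μ, 1 - μ, hμ0, hμ1, by ring, ?_⟩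
    rw [smul_smul, mul_inv_cancel₀ hμ1.ne', one_smul, add_sub_cancel]
  · rintro ⟨a, b, ⟨⟨ha, hwa⟩, hb, hwb⟩, rfl⟩
    have he := edgePoint_mem (w := w) ha hwa hb hwb
    refine ⟨he, fun p hp q hq hpq => ?_⟩
    rw [mem_levelCell] at hp hq
    obtain ⟨s, t, hs, ht, _, hst⟩ := hpq
    refine eq_edgePoint (hwa.trans hwb) (fun v hva hvb => ?_) hp.2.1 hp.2.2.2
    have h1 := congrFun hst v
    rw [edgePoint_apply_of_ne hva hvb] at h1
    simp only [Pi.add_apply, Pi.smul_apply, smul_eq_mul] at h1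
    have h2 := mul_nonneg hs.le (hp.1 v)
    have h3 := mul_nonneg ht.le (hq.1 v)
    have h4 : s * p v = 0 := by linarith
    exact (mul_eq_zero.mp h4).resolve_left hs.ne'

theorem ncard_extremePoints_levelCell (hw : ∀ v ∈ σ, w v ≠ 0) :
    (Set.extremePoints ℝ (levelCell w σ)).ncard =
      (σ.filter fun v => w v < 0).card * (σ.filter fun v => 0 < w v).card := by
  rw [extremePoints_levelCell hw, Set.InjOn.ncard_image, Set.ncard_coe_finset,
    Finset.card_product]
  rintro ⟨a, b⟩ h ⟨a', b'⟩ h' heq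
  simp only [Finset.mem_coe, Finset.mem_product, Finset.mem_filter] at h h' heq
  obtain ⟨⟨_, hwa⟩, _, hwb⟩ := h
  obtain ⟨⟨_, hwa'⟩, _, hwb'⟩ := h'
  have hpos : 0 < w b - w a := by linarith
  have hne : a ≠ b := fun h => (hwa.trans hwb).ne (congrArg w h)
  have ha : a = a' := by
    by_contra hc
    have h1 : a ≠ b' := fun h => (hwa.trans hwb').ne (congrArg w h)
    have h2 := congrFun heq a
    rw [edgePoint_left hne, edgePoint_apply_of_ne hc h1] at h2
    exact (div_pos hwb hpos).ne' h2
  have hb : b = b' := by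
    by_contra hc
    have h1 : b ≠ a' := fun h => (hwa'.trans hwb).ne' (congrArg w h)
    have h2 := congrFun heq b
    rw [edgePoint_right hne, edgePoint_apply_of_ne h1 hc] at h2
    exact (div_pos (neg_pos.mpr hwa) hpos).ne' h2
  rw [ha, hb]

end EdgePoint

end LevelCell

/-! ### The cells of a slicing -/

/-- `σ` has vertices both inside and outside of `W`. -/
def IsMixed {V : Type*} (W σ : Finset V) : Prop :=
  (∃ a ∈ σ, a ∈ W) ∧ ∃ b ∈ σ, b ∉ W

section Cells

variable {V : Type*} [Fintype V] [DecidableEq V] {M : AbstractSimplicialComplex V}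
  {F : (V → ℝ) → ℝ} {x : ℝ} {σ : Finset V}

theorem slicing_inter_geomSimplex (hF : IsRsl M F) (hσ : σ ∈ M.faces) :
    slicing M F x ∩ geomSimplex σ = levelCell (fun v => vertexValue F v - x) σ := by
  ext p
  have h : ∀ p ∈ geomSimplex σ, (F p = x ↔ ∑ v, p v * (vertexValue F v - x) = 0) := by
    intro p hp
    rw [hF.2 σ hσ p hp]
    simp only [mul_sub, Finset.sum_sub_distrib, ← Finset.sum_mul]
    rw [hp.1.2, one_mul, sub_eq_zero]
  constructor
  · rintro ⟨hp, hpσ⟩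
    exact ⟨hpσ, (h p hpσ).mp hp.2⟩
  · rintro ⟨hpσ, hp⟩
    exact ⟨⟨Set.mem_biUnion hσ hpσ, (h p hpσ).mpr hp⟩, hpσ⟩

theorem nonempty_levelCell_iff {w : V → ℝ} {W : Finset V} (hneg : ∀ v ∈ W, w v < 0)
    (hpos : ∀ v, v ∉ W → 0 < w v) : (levelCell w σ).Nonempty ↔ IsMixed W σ := by
  constructor
  · rintro ⟨p, hp⟩
    have hp' := mem_levelCell.mp hp
    obtain ⟨hn, hs, hσ, hw0⟩ := hp'
    have hz : ∀ v, p v * w v = 0 → p v = 0 := fun v hv => by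
      refine (mul_eq_zero.mp hv).resolve_right fun h => ?_
      by_cases hvW : v ∈ W
      exacts [(hneg v hvW).ne h, (hpos v hvW).ne' h]
    constructor
    · by_contra! h
      have h1 : ∀ v ∈ Finset.univ, 0 ≤ p v * w v := fun v _ => by
        by_cases hv : v ∈ σ
        · exact mul_nonneg (hn v) (hpos v (h v hv)).le
        · rw [hσ v hv, zero_mul]
      have h2 := (Finset.sum_eq_zero_iff_of_nonneg h1).mp hw0
      rw [Finset.sum_eq_zero fun v hv => hz v (h2 v hv)] at hs
      exact zero_ne_one hs
    · by_contra! h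
      have h1 : ∀ v ∈ Finset.univ, p v * w v ≤ 0 := fun v _ => by
        by_cases hv : v ∈ σ
        · exact mul_nonpos_of_nonneg_of_nonpos (hn v) (hneg v (h v hv)).le
        · rw [hσ v hv, zero_mul]
      have h2 := (Finset.sum_eq_zero_iff_of_nonpos h1).mp hw0
      rw [Finset.sum_eq_zero fun v hv => hz v (h2 v hv)] at hs
      exact zero_ne_one hs
  · rintro ⟨⟨a, ha, haW⟩, b, hb, hbW⟩
    exact ⟨_, edgePoint_mem ha (hneg a haW) hb (hpos b hbW)⟩

/-- A cell remembers its simplex, since it contains a point with support all of `σ`. -/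
theorem levelCell_injOn {w : V → ℝ} {W : Finset V} (hneg : ∀ v ∈ W, w v < 0)
    (hpos : ∀ v, v ∉ W → 0 < w v) : Set.InjOn (levelCell w) {σ | IsMixed W σ} := by
  have key : ∀ σ τ, IsMixed W σ → levelCell w σ = levelCell w τ → σ ⊆ τ := by
    rintro σ τ ⟨⟨a, ha, haW⟩, b, hb, hbW⟩ h v hv
    obtain ⟨p, hp, hp0⟩ := exists_pos_mem_levelCell ha (hneg a haW) hb (hpos b hbW)
    rw [h, mem_levelCell] at hp
    by_contra hvτ
    exact (hp0 v hv).ne' (hp.2.2.1 v hvτ)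
  exact fun σ hσ τ hτ h => (key σ τ hσ h).antisymm (key τ σ hτ h.symm)

variable {V₁ V₂ : Finset V}

theorem slicingCells_eq (h : Defines M V₁ V₂ F x) (hV : V₁ ∪ V₂ = Finset.univ) :
    slicingCells M F x = levelCell (fun v => vertexValue F v - x) ''
      {σ | σ ∈ M.faces ∧ IsMixed V₁ σ} := by
  have hneg : ∀ v ∈ V₁, vertexValue F v - x < 0 := fun v hv => sub_neg.mpr (h.2.1 v hv)
  have hpos : ∀ v, v ∉ V₁ → 0 < vertexValue F v - x := fun v hv => by
    have hv2 : v ∈ V₁ ∪ V₂ := hV ▸ Finset.mem_univ v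
    exact sub_pos.mpr (h.2.2 v ((Finset.mem_union.mp hv2).resolve_left hv))
  ext C
  constructor
  · rintro ⟨hne, σ, hσ, rfl⟩
    rw [slicing_inter_geomSimplex h.1 hσ] at hne ⊢
    exact ⟨σ, ⟨hσ, (nonempty_levelCell_iff hneg hpos).mp hne⟩, rfl⟩
  · rintro ⟨σ, ⟨hσ, hm⟩, rfl⟩
    exact ⟨(nonempty_levelCell_iff hneg hpos).mpr hm, σ, hσ,
      (slicing_inter_geomSimplex h.1 hσ).symm⟩

theorem ncard_slicingCells (h : Defines M V₁ V₂ F x) (hV : V₁ ∪ V₂ = Finset.univ)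
    {P : Set (V → ℝ) → Prop} {Q : Finset V → Prop}
    (hPQ : ∀ σ ∈ M.faces, IsMixed V₁ σ →
      (P (levelCell (fun v => vertexValue F v - x) σ) ↔ Q σ)) :
    {C | C ∈ slicingCells M F x ∧ P C}.ncard =
      {σ | σ ∈ M.faces ∧ IsMixed V₁ σ ∧ Q σ}.ncard := by
  have hneg : ∀ v ∈ V₁, vertexValue F v - x < 0 := fun v hv => sub_neg.mpr (h.2.1 v hv)
  have hpos : ∀ v, v ∉ V₁ → 0 < vertexValue F v - x := fun v hv => by
    have hv2 : v ∈ V₁ ∪ V₂ := hV ▸ Finset.mem_univ v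
    exact sub_pos.mpr (h.2.2 v ((Finset.mem_union.mp hv2).resolve_left hv))
  rw [← Set.InjOn.ncard_image ((levelCell_injOn hneg hpos).mono fun σ hσ => hσ.2.1)]
  congr 1
  ext C
  rw [slicingCells_eq h hV]
  constructor
  · rintro ⟨⟨σ, ⟨hσ, hm⟩, rfl⟩, hP⟩
    exact ⟨σ, ⟨hσ, hm, (hPQ σ hσ hm).mp hP⟩, rfl⟩
  · rintro ⟨σ, ⟨hσ, hm, hQ⟩, rfl⟩
    exact ⟨⟨σ, ⟨hσ, hm⟩, rfl⟩, (hPQ σ hσ hm).mpr hQ⟩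

theorem two_le_card_of_isMixed {W σ : Finset V} (h : IsMixed W σ) : 2 ≤ σ.card := by
  obtain ⟨⟨a, ha, haW⟩, b, hb, hbW⟩ := h
  have hne : a ≠ b := fun h => hbW (h ▸ haW)
  rw [← Finset.card_pair hne]
  exact Finset.card_le_card (Finset.insert_subset ha (Finset.singleton_subset_iff.mpr hb))

theorem isMixed_iff {W σ : Finset V} : IsMixed W σ ↔
    0 < (σ.filter (· ∈ W)).card ∧ 0 < (σ.filter (· ∉ W)).card := by
  simp only [IsMixed, Finset.card_pos, Finset.filter_nonempty_iff]

theorem cellDim_iff (h : Defines M V₁ V₂ F x) (hV : V₁ ∪ V₂ = Finset.univ) {i : ℕ}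
    (hm : IsMixed V₁ σ) :
    cellDim (levelCell (fun v => vertexValue F v - x) σ) = i ↔ σ.card = i + 2 := by
  have h2 := two_le_card_of_isMixed hm
  obtain ⟨⟨a, ha, haW⟩, b, hb, hbW⟩ := hm
  have hb2 : b ∈ V₁ ∪ V₂ := hV ▸ Finset.mem_univ b
  rw [cellDim_levelCell ha (sub_neg.mpr (h.2.1 a haW)) hb
    (sub_pos.mpr (h.2.2 b ((Finset.mem_union.mp hb2).resolve_left hbW)))]
  omega

theorem cellCount_eq (h : Defines M V₁ V₂ F x) (hV : V₁ ∪ V₂ = Finset.univ) (i : ℕ) :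
    cellCount M F x i = {σ | σ ∈ M.faces ∧ IsMixed V₁ σ ∧ σ.card = i + 2}.ncard :=
  ncard_slicingCells h hV fun _ _ hm => cellDim_iff h hV hm

theorem quadCount_eq (h : Defines M V₁ V₂ F x) (hV : V₁ ∪ V₂ = Finset.univ) :
    quadCount M F x =
      {σ | σ ∈ M.faces ∧ IsMixed V₁ σ ∧ σ.card = 4 ∧ (σ.filter (· ∈ V₁)).card = 2}.ncard := by
  refine ncard_slicingCells h hV fun σ hσ hm => ?_
  have hneg : ∀ v ∈ V₁, vertexValue F v - x < 0 := fun v hv => sub_neg.mpr (h.2.1 v hv)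
  have hpos : ∀ v, v ∉ V₁ → 0 < vertexValue F v - x := fun v hv => by
    have hv2 : v ∈ V₁ ∪ V₂ := hV ▸ Finset.mem_univ v
    exact sub_pos.mpr (h.2.2 v ((Finset.mem_union.mp hv2).resolve_left hv))
  have e1 : ∀ v, vertexValue F v - x < 0 ↔ v ∈ V₁ := fun v =>
    ⟨fun hv => by_contra fun hc => hv.not_gt (hpos v hc), hneg v⟩
  have e2 : ∀ v, 0 < vertexValue F v - x ↔ v ∉ V₁ := fun v =>
    ⟨fun hv hc => hv.not_gt (hneg v hc), hpos v⟩
  rw [cellDim_iff h hV hm, ncard_extremePoints_levelCell]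
  · simp only [e1, e2]
    have h1 := Finset.card_filter_add_card_filter_not (s := σ) (· ∈ V₁)
    refine and_congr_right fun h4 => ?_
    rw [h4] at h1
    generalize (σ.filter (· ∈ V₁)).card = k at *
    generalize (σ.filter (· ∉ V₁)).card = l at *
    have hl : l = 4 - k := by omega
    subst hl
    have hk : k ≤ 4 := by omega
    -- The cell has `k(4 - k)` vertices, which is four only for `k = 2`.
    interval_cases k <;> simp
  · intro v _
    by_cases hv : v ∈ V₁
    exacts [(hneg v hv).ne, (hpos v hv).ne']

end Cells

/-! ### Counting faces of combinatorial 3-manifolds -/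

/-! ### Relabellings and links -/

section Map

variable {α : Type*} [DecidableEq α] {K : PreAbstractSimplicialComplex α} {φ : α → ℕ}

theorem cofaceVertices_map (hφ : Function.Injective φ) (ρ : Finset α) :
    cofaceVertices (K.map φ) (ρ.image φ) = φ '' cofaceVertices K ρ := by
  ext w
  constructor
  · rintro ⟨hw, s, hs, hsw⟩
    change s.image φ = insert w (ρ.image φ) at hsw
    have h1 : w ∈ s.image φ := hsw ▸ Finset.mem_insert_self _ _
    obtain ⟨v, -, rfl⟩ := Finset.mem_image.mp h1
    rw [← Finset.image_insert] at hsw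
    have h2 := Finset.image_injective hφ hsw
    exact ⟨v, ⟨fun h => hw (Finset.mem_image_of_mem φ h), h2 ▸ hs⟩, rfl⟩
  · rintro ⟨v, ⟨hv, hs⟩, rfl⟩
    refine ⟨fun h => hv ?_, insert v ρ, hs, Finset.image_insert _ _ _⟩
    obtain ⟨u, hu, huv⟩ := Finset.mem_image.mp h
    exact hφ huv ▸ hu

theorem isClosedPseudomanifold_of_map (hφ : Function.Injective φ) {d : ℕ}
    (h : IsClosedPseudomanifold d (K.map φ)) : IsClosedPseudomanifold d K := by
  refine ⟨fun σ hσ => ?_, fun ρ hρ hρd => ?_⟩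
  · rw [← Finset.card_image_of_injective σ hφ]
    exact h.1 _ ⟨σ, hσ, rfl⟩
  · have := h.2 _ ⟨ρ, hρ, rfl⟩ ((Finset.card_image_of_injective ρ hφ).trans hρd)
    simp only at this
    rwa [cofaceVertices_map hφ, Set.ncard_image_of_injective _ hφ] at this

theorem altSum_map (hφ : Function.Injective φ) : altSum (K.map φ).faces = altSum K.faces := by
  change ∑ᶠ σ ∈ (fun s => s.image φ) '' K.faces, (-1 : ℤ) ^ σ.card = _
  rw [finsum_mem_image fun σ _ τ _ h => Finset.image_injective hφ h, altSum]
  exact finsum_mem_congr rfl fun σ _ => by rw [Finset.card_image_of_injective σ hφ]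

theorem cofaceVertices_link {u : α} {σ : Finset α} (hu : u ∈ σ) :
    cofaceVertices (link K u) (σ.erase u) = cofaceVertices K σ := by
  ext v
  simp only [cofaceVertices, link, Set.mem_ofPred_eq, Finset.insert_nonempty, true_and]
  by_cases hvu : v = u
  · subst hvu
    simp [hu]
  · rw [Finset.insert_comm, Finset.insert_erase hu]
    simp [hvu, Ne.symm hvu]

theorem IsCombinatorialSphere.invariants (h : IsCombinatorialSphere 2 K) :
    IsClosedPseudomanifold 2 K ∧ altSum K.faces = -2 := by
  obtain ⟨φ, hφ, h⟩ := h
  have := invariants_of_eqvGen h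
  exact ⟨isClosedPseudomanifold_of_map hφ this.1, (altSum_map hφ).symm.trans this.2⟩

end Map

/-! ### Face numbers by double counting -/

section Counting

variable {V : Type*} [Fintype V] [DecidableEq V] {M : AbstractSimplicialComplex V}

open Classical in
/-- The faces with `k` vertices. -/
noncomputable def kFaces (M : AbstractSimplicialComplex V) (k : ℕ) : Finset (Finset V) :=
  Finset.univ.filter fun σ => σ ∈ M.faces ∧ σ.card = k

theorem mem_kFaces {k : ℕ} {σ : Finset V} : σ ∈ kFaces M k ↔ σ ∈ M.faces ∧ σ.card = k := by
  simp [kFaces]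

/-- In the link of one vertex of the triangle, the opposite edge lies in two triangles because the
link is a closed surface. -/
theorem ncard_cofaceVertices_of_card_eq_three (hM : IsCombinatorial3Manifold M) {σ : Finset V}
    (hσ : σ ∈ M.faces) (h3 : σ.card = 3) :
    (cofaceVertices M.toPreAbstractSimplicialComplex σ).ncard = 2 := by
  obtain ⟨u, hu⟩ := (M.isRelLowerSet_faces hσ).1
  have h := (hM.2.2 u).invariants.1
  have hc : (σ.erase u).card = 2 := by rw [Finset.card_erase_of_mem hu, h3]
  rw [← cofaceVertices_link hu]
  refine h.2 _ ⟨?_, Finset.notMem_erase u σ, by rwa [Finset.insert_erase hu]⟩ hc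
  exact Finset.card_pos.mp (by omega)

open Classical in
-- Double counting of pairs of a tetrahedron and one of its triangles satisfying `Q`, the triangle
-- being recorded by the vertex it omits. It is applied to all triangles and to the mixed ones.
theorem sum_card_filter_erase (hM : IsCombinatorial3Manifold M) (Q : Finset V → Prop) :
    ∑ τ ∈ kFaces M 4, (τ.filter fun y => Q (τ.erase y)).card =
      2 * ((kFaces M 3).filter Q).card := by
  have h1 : ∑ σ ∈ (kFaces M 3).filter Q,
      (Finset.univ.filter fun v => v ∉ σ ∧ insert v σ ∈ M.faces).card =
      2 * ((kFaces M 3).filter Q).card := by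
    rw [Finset.sum_const_nat (m := 2), mul_comm]
    intro σ hσ
    rw [Finset.mem_filter, mem_kFaces] at hσ
    rw [← ncard_cofaceVertices_of_card_eq_three hM hσ.1.1 hσ.1.2, ← Set.ncard_coe_finset]
    congr 1
    ext v
    simp [cofaceVertices]
  rw [← h1, ← Finset.card_sigma, ← Finset.card_sigma]
  refine Finset.card_nbij' (fun p => ⟨p.1.erase p.2, p.2⟩) (fun p => ⟨insert p.2 p.1, p.2⟩)
    ?_ ?_ ?_ ?_
  · rintro ⟨τ, y⟩ h
    simp only [Finset.mem_coe, Finset.mem_sigma, Finset.mem_filter, mem_kFaces, Finset.mem_univ,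
      true_and] at h ⊢
    obtain ⟨⟨hτ, h4⟩, hy, hQ⟩ := h
    have hc : (τ.erase y).card = 3 := by rw [Finset.card_erase_of_mem hy, h4]
    refine ⟨⟨⟨mem_of_subset_face hτ (Finset.erase_subset y τ) ?_, hc⟩, hQ⟩,
      Finset.notMem_erase y τ, by rwa [Finset.insert_erase hy]⟩
    exact Finset.card_pos.mp (by omega)
  · rintro ⟨σ, v⟩ h
    simp only [Finset.mem_coe, Finset.mem_sigma, Finset.mem_filter, mem_kFaces, Finset.mem_univ,
      true_and] at h ⊢
    obtain ⟨⟨⟨hσ, h3⟩, hQ⟩, hv, hins⟩ := h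
    refine ⟨⟨hins, by rw [Finset.card_insert_of_notMem hv, h3]⟩, Finset.mem_insert_self v σ, ?_⟩
    rwa [Finset.erase_insert hv]
  · rintro ⟨τ, y⟩ h
    simp only [Finset.mem_coe, Finset.mem_sigma, Finset.mem_filter] at h
    simp [Finset.insert_erase h.2.1]
  · rintro ⟨σ, v⟩ h
    simp only [Finset.mem_coe, Finset.mem_sigma, Finset.mem_filter, Finset.mem_univ,
      true_and] at h
    simp [Finset.erase_insert h.2.1]

open Classical in
theorem altSum_link (v : V) : altSum (link M.toPreAbstractSimplicialComplex v).faces =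
    ∑ σ ∈ Finset.univ.filter (fun σ => σ ∈ M.faces ∧ 1 < σ.card),
      if v ∈ σ then (-1 : ℤ) ^ (σ.card - 1) else 0 := by
  have h : (link M.toPreAbstractSimplicialComplex v).faces = (fun σ => σ.erase v) ''
      ((Finset.univ.filter (fun σ => (σ ∈ M.faces ∧ 1 < σ.card) ∧ v ∈ σ) : Finset (Finset V)) :
        Set (Finset V)) := by
    ext τ
    simp only [link, Set.mem_ofPred_eq, Set.mem_image, Finset.mem_coe, Finset.mem_filter,
      Finset.mem_univ, true_and]
    constructor
    · rintro ⟨hne, hv, hτ⟩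
      refine ⟨insert v τ, ⟨⟨hτ, ?_⟩, Finset.mem_insert_self v τ⟩, Finset.erase_insert hv⟩
      rw [Finset.card_insert_of_notMem hv]
      have := Finset.card_pos.mpr hne
      omega
    · rintro ⟨σ, ⟨⟨hσ, h1⟩, hv⟩, rfl⟩
      refine ⟨Finset.card_pos.mp ?_, Finset.notMem_erase v σ, by rwa [Finset.insert_erase hv]⟩
      rw [Finset.card_erase_of_mem hv]
      omega
  rw [altSum, h, finsum_mem_image, finsum_mem_coe_finset, ← Finset.sum_filter,
    Finset.filter_filter]
  · refine Finset.sum_congr rfl fun σ hσ => ?_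
    rw [Finset.mem_filter] at hσ
    rw [Finset.card_erase_of_mem hσ.2.2]
  · intro σ hσ τ hτ hστ
    simp only [Finset.mem_coe, Finset.mem_filter] at hσ hτ
    rw [← Finset.insert_erase hσ.2.2, ← Finset.insert_erase hτ.2.2]
    exact congrArg (insert v) hστ

open Classical in
-- Sum the Euler characteristics of all vertex links. A face with `i` vertices contributes to `i`
-- links, each time as a face with `i - 1` vertices.
theorem card_kFaces_relation (hM : IsCombinatorial3Manifold M) :
    2 * ((kFaces M 2).card : ℤ) - 3 * (kFaces M 3).card + 4 * (kFaces M 4).card =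
      2 * Fintype.card V := by
  have h1 : ∑ v : V, altSum (link M.toPreAbstractSimplicialComplex v).faces =
      -2 * Fintype.card V := by
    rw [Finset.sum_congr rfl fun v _ => (hM.2.2 v).invariants.2]
    simp [mul_comm]
  simp_rw [altSum_link] at h1
  rw [Finset.sum_comm] at h1
  have h2 : ∀ σ : Finset V, (∑ v : V, if v ∈ σ then (-1 : ℤ) ^ (σ.card - 1) else 0) =
      σ.card * (-1 : ℤ) ^ (σ.card - 1) := fun σ => by
    rw [← Finset.sum_filter]
    simp
  simp_rw [h2] at h1
  have hmaps : ∀ σ ∈ Finset.univ.filter (fun σ => σ ∈ M.faces ∧ 1 < σ.card),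
      σ.card ∈ ({2, 3, 4} : Finset ℕ) := by
    intro σ hσ
    rw [Finset.mem_filter] at hσ
    have := (hM.2.1 σ hσ.2.1).1
    simp only [Finset.mem_insert, Finset.mem_singleton]
    omega
  rw [← Finset.sum_fiberwise_of_maps_to hmaps] at h1
  have h3 : ∀ i ∈ ({2, 3, 4} : Finset ℕ),
      ∑ σ ∈ (Finset.univ.filter (fun σ => σ ∈ M.faces ∧ 1 < σ.card)).filter (fun σ => σ.card = i),
        (σ.card : ℤ) * (-1 : ℤ) ^ (σ.card - 1) = (kFaces M i).card * (i * (-1 : ℤ) ^ (i - 1)) := by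
    intro i hi
    have hset : (Finset.univ.filter (fun σ => σ ∈ M.faces ∧ 1 < σ.card)).filter
        (fun σ => σ.card = i) = kFaces M i := by
      ext σ
      simp only [Finset.mem_insert, Finset.mem_singleton] at hi
      simp only [Finset.mem_filter, Finset.mem_univ, true_and, mem_kFaces]
      constructor
      · exact fun h => ⟨h.1.1, h.2⟩
      · exact fun h => ⟨⟨h.1, by omega⟩, h.2⟩
    rw [hset, Finset.sum_congr rfl fun σ hσ => by rw [(mem_kFaces.mp hσ).2], Finset.sum_const,
      nsmul_eq_mul]
  rw [Finset.sum_congr rfl h3] at h1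
  simp at h1
  linarith

theorem four_mul_card_kFaces_four (hM : IsCombinatorial3Manifold M) :
    4 * (kFaces M 4).card = 2 * (kFaces M 3).card := by
  classical
  have h := sum_card_filter_erase hM fun _ => True
  simp only [Finset.filter_true] at h
  rw [Finset.sum_congr rfl fun τ hτ => (mem_kFaces.mp hτ).2, Finset.sum_const, smul_eq_mul] at h
  omega

/-- Neighborliness is stated as an equality of numbers. Since every singleton is a face, that number
counts all pairs, so no pair can be missing. -/
theorem kFaces_two_of_isNeighborly (hN : IsNeighborly 2 M) {σ : Finset V} (hσ : σ.card = 2) :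
    σ ∈ M.faces := by
  have hc : ∀ k, faceCount M k = (kFaces M k).card := fun k => by
    rw [faceCount, ← Set.ncard_coe_finset]
    congr 1
    ext σ
    simp [mem_kFaces]
  have h1 : (kFaces M 1).card = Fintype.card V := by
    have : kFaces M 1 = Finset.univ.powersetCard 1 := by
      ext σ
      simp only [mem_kFaces, Finset.mem_powersetCard, Finset.subset_univ, true_and]
      refine ⟨fun h => h.2, fun h => ⟨?_, h⟩⟩
      obtain ⟨v, rfl⟩ := Finset.card_eq_one.mp h
      exact M.singleton_mem v
    rw [this, Finset.card_powersetCard, Finset.card_univ, Nat.choose_one_right]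
  rw [IsNeighborly, hc, hc, h1] at hN
  have h2 : kFaces M 2 = Finset.univ.powersetCard 2 := by
    refine Finset.eq_of_subset_of_card_le (fun σ hσ => ?_) ?_
    · exact Finset.mem_powersetCard.mpr ⟨Finset.subset_univ σ, (mem_kFaces.mp hσ).2⟩
    · rw [hN, Finset.card_powersetCard, Finset.card_univ]
  have h3 : σ ∈ kFaces M 2 := h2 ▸ Finset.mem_powersetCard.mpr ⟨Finset.subset_univ σ, hσ⟩
  exact (mem_kFaces.mp h3).1

theorem card_kFaces_two (hN : IsNeighborly 2 M) :
    (kFaces M 2).card = (Fintype.card V).choose 2 := by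
  have : kFaces M 2 = Finset.univ.powersetCard 2 := by
    ext σ
    simp only [mem_kFaces, Finset.mem_powersetCard, Finset.subset_univ, true_and]
    exact ⟨fun h => h.2, fun h => ⟨kFaces_two_of_isNeighborly hN h, h⟩⟩
  rw [this, Finset.card_powersetCard, Finset.card_univ]

open Classical in
theorem card_mixed_kFaces_two (hN : IsNeighborly 2 M) {V₁ V₂ : Finset V} (hd : Disjoint V₁ V₂)
    (hV : V₁ ∪ V₂ = Finset.univ) :
    ((kFaces M 2).filter (IsMixed V₁)).card = V₁.card * V₂.card := by
  rw [← Finset.card_product]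
  symm
  have hV2 : ∀ b, b ∈ V₂ ↔ b ∉ V₁ := fun b => by
    have hb : b ∈ V₁ ∪ V₂ := hV ▸ Finset.mem_univ b
    exact ⟨fun h h' => Finset.disjoint_left.mp hd h' h, (Finset.mem_union.mp hb).resolve_left⟩
  refine Finset.card_bij (fun e _ => {e.1, e.2}) ?_ ?_ ?_
  · rintro ⟨a, b⟩ h
    rw [Finset.mem_product, hV2] at h
    have hc : ({a, b} : Finset V).card = 2 := Finset.card_pair fun hab => h.2 (hab ▸ h.1)
    rw [Finset.mem_filter, mem_kFaces]
    exact ⟨⟨kFaces_two_of_isNeighborly hN hc, hc⟩, ⟨a, by simp, h.1⟩, ⟨b, by simp, h.2⟩⟩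
  · rintro ⟨a, b⟩ h ⟨a', b'⟩ h' heq
    rw [Finset.mem_product, hV2] at h h'
    simp only at h h' heq
    have ha : a ∈ ({a', b'} : Finset V) := heq ▸ Finset.mem_insert_self a {b}
    have hb : b ∈ ({a', b'} : Finset V) :=
      heq ▸ Finset.mem_insert_of_mem (Finset.mem_singleton_self b)
    simp only [Finset.mem_insert, Finset.mem_singleton] at ha hb
    have ha' : a = a' := ha.resolve_right fun e => h'.2 (e ▸ h.1)
    have hb' : b = b' := hb.resolve_left fun e => h.2 (e ▸ h'.1)
    rw [ha', hb']
  · intro σ hσ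
    rw [Finset.mem_filter, mem_kFaces] at hσ
    obtain ⟨⟨_, hc⟩, ⟨a, ha, haV⟩, b, hb, hbV⟩ := hσ
    refine ⟨(a, b), Finset.mem_product.mpr ⟨haV, (hV2 b).mpr hbV⟩, ?_⟩
    refine Finset.eq_of_subset_of_card_le
      (Finset.insert_subset ha (Finset.singleton_subset_iff.mpr hb)) ?_
    rw [hc, Finset.card_pair fun hab : a = b => hbV (hab ▸ haV)]

open Classical in
/-- A tetrahedron with two vertices on each side has four mixed triangles, any other mixed
tetrahedron has three. -/
theorem card_mixed_triangles (W : Finset V) {τ : Finset V} (h4 : τ.card = 4) :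
    (τ.filter fun y => IsMixed W (τ.erase y)).card =
      3 * (if IsMixed W τ then 1 else 0) + if (τ.filter (· ∈ W)).card = 2 then 1 else 0 := by
  have h1 := Finset.card_filter_add_card_filter_not (s := τ) (· ∈ W)
  have hmem : ∀ y ∈ τ, y ∈ W → (IsMixed W (τ.erase y) ↔
      1 < (τ.filter (· ∈ W)).card ∧ 0 < (τ.filter (· ∉ W)).card) := by
    intro y hy hW
    rw [isMixed_iff, Finset.filter_erase, Finset.filter_erase,
      Finset.card_erase_of_mem (by simp [hy, hW]),
      Finset.erase_eq_of_notMem (a := y) (s := τ.filter (· ∉ W)) (by simp [hW])]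
    omega
  have hnot : ∀ y ∈ τ, y ∉ W → (IsMixed W (τ.erase y) ↔
      0 < (τ.filter (· ∈ W)).card ∧ 1 < (τ.filter (· ∉ W)).card) := by
    intro y hy hW
    rw [isMixed_iff, Finset.filter_erase, Finset.filter_erase,
      Finset.erase_eq_of_notMem (a := y) (s := τ.filter (· ∈ W)) (by simp [hW]),
      Finset.card_erase_of_mem (by simp [hy, hW])]
    omega
  -- Deleting a vertex keeps `τ` mixed exactly when its own side has another vertex and the opposite
  -- side is nonempty; so each side contributes all of its vertices or none.
  have h2 : (τ.filter fun y => IsMixed W (τ.erase y)).card =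
      (if 1 < (τ.filter (· ∈ W)).card ∧ 0 < (τ.filter (· ∉ W)).card
        then (τ.filter (· ∈ W)).card else 0) +
      if 0 < (τ.filter (· ∈ W)).card ∧ 1 < (τ.filter (· ∉ W)).card
        then (τ.filter (· ∉ W)).card else 0 := by
    rw [← Finset.card_filter_add_card_filter_not (s := τ.filter fun y => IsMixed W (τ.erase y))
      (· ∈ W), Finset.filter_filter, Finset.filter_filter]
    congr 1
    · rw [Finset.filter_congr (q := fun y => y ∈ W ∧
        (1 < (τ.filter (· ∈ W)).card ∧ 0 < (τ.filter (· ∉ W)).card))]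
      · rw [← Finset.filter_filter, Finset.filter_const]
        split_ifs <;> simp
      · intro y hy
        rw [and_comm]
        exact and_congr_right fun hW => hmem y hy hW
    · rw [Finset.filter_congr (q := fun y => y ∉ W ∧
        (0 < (τ.filter (· ∈ W)).card ∧ 1 < (τ.filter (· ∉ W)).card))]
      · rw [← Finset.filter_filter, Finset.filter_const]
        split_ifs <;> simp
      · intro y hy
        rw [and_comm]
        exact and_congr_right fun hW => hnot y hy hW
  rw [h2, isMixed_iff]
  rw [h4] at h1
  generalize (τ.filter (· ∈ W)).card = k at *
  generalize (τ.filter (· ∉ W)).card = l at *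
  have hl : l = 4 - k := by omega
  subst hl
  have hk : k ≤ 4 := by omega
  interval_cases k <;> simp

open Classical in
theorem two_mul_card_mixed_kFaces_three (hM : IsCombinatorial3Manifold M) (W : Finset V) :
    2 * ((kFaces M 3).filter (IsMixed W)).card = 3 * ((kFaces M 4).filter (IsMixed W)).card +
      ((kFaces M 4).filter fun τ => (τ.filter (· ∈ W)).card = 2).card := by
  rw [← sum_card_filter_erase hM,
    Finset.sum_congr rfl fun τ hτ => card_mixed_triangles W (mem_kFaces.mp hτ).2,
    Finset.sum_add_distrib, ← Finset.mul_sum, ← Finset.card_filter, ← Finset.card_filter]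

end Counting

/-! ### Euler characteristic of the slicing and the inequality -/

section Slicing

variable {V : Type*} [Fintype V] [DecidableEq V] {M : AbstractSimplicialComplex V}
  {F : (V → ℝ) → ℝ} {x : ℝ} {V₁ V₂ : Finset V}

open Classical in
theorem cellCount_eq_card (h : Defines M V₁ V₂ F x) (hV : V₁ ∪ V₂ = Finset.univ) (i : ℕ) :
    cellCount M F x i = ((kFaces M (i + 2)).filter (IsMixed V₁)).card := by
  rw [cellCount_eq h hV, ← Set.ncard_coe_finset]
  congr 1
  ext σ
  simp only [Set.mem_ofPred_eq, Finset.mem_coe, Finset.mem_filter, mem_kFaces]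
  tauto

theorem quadCount_eq_card (h : Defines M V₁ V₂ F x) (hV : V₁ ∪ V₂ = Finset.univ) :
    quadCount M F x = ((kFaces M 4).filter fun τ => (τ.filter (· ∈ V₁)).card = 2).card := by
  rw [quadCount_eq h hV, ← Set.ncard_coe_finset]
  congr 1
  ext σ
  simp only [Set.mem_ofPred_eq, Finset.mem_coe, Finset.mem_filter, mem_kFaces]
  constructor
  · rintro ⟨h1, _, h2, h3⟩
    exact ⟨⟨h1, h2⟩, h3⟩
  · rintro ⟨⟨h1, h2⟩, h3⟩
    have h4 := Finset.card_filter_add_card_filter_not (s := σ) (· ∈ V₁)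
    exact ⟨h1, isMixed_iff.mpr ⟨by omega, by omega⟩, h2, h3⟩

/-- The number of tetrahedra of a 2-neighborly combinatorial 3-manifold. -/
theorem card_kFaces_four (hM : IsCombinatorial3Manifold M) (hN : IsNeighborly 2 M) :
    ((kFaces M 4).card : ℝ) = (Fintype.card V : ℝ) * (Fintype.card V - 3) / 2 := by
  have h1 := card_kFaces_relation hM
  have h2 := four_mul_card_kFaces_four hM
  rw [card_kFaces_two hN] at h1
  have h3 : ((Fintype.card V).choose 2 : ℝ) = (Fintype.card V : ℝ) * (Fintype.card V - 1) / 2 :=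
    Nat.cast_choose_two ℝ _
  have h1' : 2 * ((Fintype.card V).choose 2 : ℝ) - 3 * (kFaces M 3).card +
      4 * (kFaces M 4).card = 2 * Fintype.card V := by exact_mod_cast h1
  have h2' : 4 * ((kFaces M 4).card : ℝ) = 2 * (kFaces M 3).card := by exact_mod_cast h2
  rw [h3] at h1'
  linarith

open Classical in
-- The number of mixed triangles is eliminated using their incidences with tetrahedra.
theorem two_mul_eulerChar (hM : IsCombinatorial3Manifold M) (hN : IsNeighborly 2 M)
    (hd : Disjoint V₁ V₂) (hV : V₁ ∪ V₂ = Finset.univ) (h : Defines M V₁ V₂ F x) :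
    2 * (eulerChar M F x : ℝ) = 2 * (V₁.card * V₂.card) - quadCount M F x -
      ((kFaces M 4).filter (IsMixed V₁)).card := by
  have h1 := two_mul_card_mixed_kFaces_three hM V₁
  have h2 := card_mixed_kFaces_two hN hd hV
  rw [← quadCount_eq_card h hV] at h1
  have h1' : 2 * (((kFaces M 3).filter (IsMixed V₁)).card : ℝ) =
      3 * ((kFaces M 4).filter (IsMixed V₁)).card + quadCount M F x := by exact_mod_cast h1
  have h2' : (((kFaces M 2).filter (IsMixed V₁)).card : ℝ) = V₁.card * V₂.card := by
    exact_mod_cast h2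
  rw [eulerChar, cellCount_eq_card h hV, cellCount_eq_card h hV, cellCount_eq_card h hV]
  push_cast
  linarith

theorem quadCount_ge (hM : IsCombinatorial3Manifold M) (hN : IsNeighborly 2 M)
    (hd : Disjoint V₁ V₂) (hV : V₁ ∪ V₂ = Finset.univ) {c : ℝ}
    (hc : (V₁.card : ℝ) + c = (V₂.card : ℝ) - c) (h : Defines M V₁ V₂ F x) :
    (quadCount M F x : ℝ) ≥
      4 * genus M F x + 3 * (Fintype.card V : ℝ) / 2 - (4 + 2 * c ^ 2) := by
  classical
  have h1 := two_mul_eulerChar hM hN hd hV h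
  -- The only estimate in the argument: it is an equality exactly when every tetrahedron is mixed.
  have h2 : (((kFaces M 4).filter (IsMixed V₁)).card : ℝ) ≤ (kFaces M 4).card := by
    exact_mod_cast Finset.card_filter_le _ _
  rw [card_kFaces_four hM hN] at h2
  have h3 : (V₁.card : ℝ) + V₂.card = Fintype.card V := by
    rw [← Finset.card_univ, ← hV, Finset.card_union_of_disjoint hd]
    push_cast
    ring
  have h4 : (V₁.card : ℝ) * V₂.card = (Fintype.card V : ℝ) ^ 2 / 4 - c ^ 2 := by
    have e1 : (V₁.card : ℝ) = Fintype.card V / 2 - c := by linarith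
    have e2 : (V₂.card : ℝ) = Fintype.card V / 2 + c := by linarith
    rw [e1, e2]; ring
  rw [h4] at h1
  rw [genus]
  linarith

end Slicing

/-! ### Stacked spheres -/

/-- The condition on `σ` to lie in a triangle `0, j, j + 1` or `1, j, j + 1` with
`2 ≤ j < N - 1`, or in `0, 1, 2` or `0, 1, N - 1`. -/
def InStackedTriangle (N : ℕ) (σ : Finset ℕ) : Prop :=
  (∃ j, 2 ≤ j ∧ j + 1 < N ∧
    ((∀ y ∈ σ, y = 0 ∨ y = j ∨ y = j + 1) ∨ ∀ y ∈ σ, y = 1 ∨ y = j ∨ y = j + 1)) ∨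
  (∀ y ∈ σ, y = 0 ∨ y = 1 ∨ y = 2) ∨ ∀ y ∈ σ, y = 0 ∨ y = 1 ∨ y + 1 = N

theorem InStackedTriangle.mono {N : ℕ} {σ τ : Finset ℕ} (h : InStackedTriangle N τ)
    (hσ : σ ⊆ τ) : InStackedTriangle N σ := by
  rcases h with ⟨j, h1, h2, h | h⟩ | h | h
  · exact Or.inl ⟨j, h1, h2, Or.inl fun y hy => h y (hσ hy)⟩
  · exact Or.inl ⟨j, h1, h2, Or.inr fun y hy => h y (hσ hy)⟩
  · exact Or.inr (Or.inl fun y hy => h y (hσ hy))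
  · exact Or.inr (Or.inr fun y hy => h y (hσ hy))

/-- The boundary complex of the cyclic 3-polytope with `N` vertices. -/
def stackedSphere (N : ℕ) : PreAbstractSimplicialComplex ℕ where
  faces := {σ | σ.Nonempty ∧ InStackedTriangle N σ}
  isRelLowerSet_faces := by
    rintro σ ⟨hne, hσ⟩
    exact ⟨hne, fun t hts ht => ⟨ht, hσ.mono hts⟩⟩

theorem stackedSphere_four : stackedSphere 4 = simplexBoundary 2 := by
  ext σ
  simp only [stackedSphere, simplexBoundary, Set.mem_ofPred_eq]
  refine and_congr_right fun _ => ?_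
  constructor
  · intro h
    have key : ∀ x < 4, (∀ y ∈ σ, y < 4 ∧ y ≠ x) → σ ⊂ Finset.range (2 + 2) := by
      intro x hx hy
      refine (Finset.ssubset_iff_of_subset fun y h => Finset.mem_range.mpr (hy y h).1).mpr
        ⟨x, Finset.mem_range.mpr hx, fun h => (hy x h).2 rfl⟩
    rcases h with ⟨j, h1, h2, h | h⟩ | h | h
    · exact key 1 (by omega) fun y hy => by have := h y hy; omega
    · exact key 0 (by omega) fun y hy => by have := h y hy; omega
    · exact key 3 (by omega) fun y hy => by have := h y hy; omega
    · exact key 2 (by omega) fun y hy => by have := h y hy; omega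
  · intro h
    obtain ⟨x, hx, hxσ⟩ := Finset.exists_of_ssubset h
    have hlt : ∀ y ∈ σ, y < 4 ∧ y ≠ x := fun y hy =>
      ⟨Finset.mem_range.mp (h.1 hy), fun hyx => hxσ (hyx ▸ hy)⟩
    have hx4 : x < 4 := Finset.mem_range.mp hx
    interval_cases x
    · exact Or.inl ⟨2, by omega, by omega, Or.inr fun y hy => by have := hlt y hy; omega⟩
    · exact Or.inl ⟨2, by omega, by omega, Or.inl fun y hy => by have := hlt y hy; omega⟩
    · exact Or.inr (Or.inr fun y hy => by have := hlt y hy; omega)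
    · exact Or.inr (Or.inl fun y hy => by have := hlt y hy; omega)

/-- Coning off the triangle `0, 1, N - 1` creates `0, N - 1, N` and `1, N - 1, N`, the two triangles
for `j = N - 1`, and `0, 1, N`, the new end triangle. -/
theorem stellar_stackedSphere {N : ℕ} (hN : 4 ≤ N) :
    stellar (stackedSphere N) {0, 1, N - 1} N = stackedSphere (N + 1) := by
  have hsub : ∀ τ : Finset ℕ, {0, 1, N - 1} ⊆ τ ↔ 0 ∈ τ ∧ 1 ∈ τ ∧ N - 1 ∈ τ := fun τ => by
    simp [Finset.insert_subset_iff]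
  -- Within `{0, 1, N - 1, N}`, a set missing a vertex of the old triangle lies in one of the three
  -- new ones.
  have htri : ∀ σ : Finset ℕ, (∀ y ∈ σ, y = 0 ∨ y = 1 ∨ y + 1 = N ∨ y = N) →
      ¬ (0 ∈ σ ∧ 1 ∈ σ ∧ N - 1 ∈ σ) → InStackedTriangle (N + 1) σ := by
    intro σ h hA
    by_cases h0 : 0 ∈ σ
    · by_cases h1 : 1 ∈ σ
      · refine Or.inr (Or.inr fun y hy => ?_)
        have h2 : y ≠ N - 1 := fun e => hA ⟨h0, h1, e ▸ hy⟩
        have := h y hy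
        omega
      · refine Or.inl ⟨N - 1, by omega, by omega, Or.inl fun y hy => ?_⟩
        have h2 : y ≠ 1 := fun e => h1 (e ▸ hy)
        have := h y hy
        omega
    · refine Or.inl ⟨N - 1, by omega, by omega, Or.inr fun y hy => ?_⟩
      have h2 : y ≠ 0 := fun e => h0 (e ▸ hy)
      have := h y hy
      omega
  ext σ
  constructor
  · rintro (⟨⟨hne, h⟩, hA⟩ | ⟨τ, hA, ⟨hne, h⟩, rfl⟩)
    · refine ⟨hne, ?_⟩
      rcases h with ⟨j, h1, h2, h⟩ | h | h
      · exact Or.inl ⟨j, h1, by omega, h⟩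
      · exact Or.inr (Or.inl h)
      · exact htri σ (fun y hy => by have := h y hy; omega) (by rwa [← hsub])
    · refine ⟨Finset.insert_nonempty N τ, htri _ ?_ ?_⟩
      · have m0 : 0 ∈ τ ∪ {0, 1, N - 1} := by simp
        have m1 : 1 ∈ τ ∪ {0, 1, N - 1} := by simp
        have m2 : N - 1 ∈ τ ∪ {0, 1, N - 1} := by simp
        have hτ : ∀ y ∈ τ, y = 0 ∨ y = 1 ∨ y + 1 = N := by
          intro y hy
          rcases h with ⟨j, h1, h2, h | h⟩ | h | h
          · have := h 1 m1; omega
          · have := h 0 m0; omega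
          · have := h _ m2; omega
          · exact h y (Finset.mem_union_left _ hy)
        intro y hy
        rcases Finset.mem_insert.mp hy with hy | hy
        · omega
        · have := hτ y hy; omega
      · rw [hsub] at hA
        rintro ⟨h0, h1, h2⟩
        refine hA ⟨Finset.mem_of_mem_insert_of_ne h0 (by omega),
          Finset.mem_of_mem_insert_of_ne h1 (by omega),
          Finset.mem_of_mem_insert_of_ne h2 (by omega)⟩
  · rintro ⟨hne, h⟩
    have hnew : (∀ y ∈ σ, y = 0 ∨ y = 1 ∨ y + 1 = N ∨ y = N) → N ∈ σ →
        ¬ (0 ∈ σ ∧ 1 ∈ σ ∧ N - 1 ∈ σ) → σ ∈ (stellar (stackedSphere N) {0, 1, N - 1} N).faces := by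
      intro hσ hNσ hA
      refine Or.inr ⟨σ.erase N, ?_, ⟨?_, Or.inr (Or.inr fun y hy => ?_)⟩,
        (Finset.insert_erase hNσ).symm⟩
      · rw [hsub]
        exact fun ⟨h0, h1, h2⟩ => hA ⟨Finset.mem_of_mem_erase h0, Finset.mem_of_mem_erase h1,
          Finset.mem_of_mem_erase h2⟩
      · exact ⟨0, by simp⟩
      · simp only [Finset.mem_union, Finset.mem_erase, Finset.mem_insert,
          Finset.mem_singleton] at hy
        rcases hy with hy | hy
        · have := hσ y hy.2; omega
        · omega
    have hold : InStackedTriangle N σ → ¬ (0 ∈ σ ∧ 1 ∈ σ ∧ N - 1 ∈ σ) →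
        σ ∈ (stellar (stackedSphere N) {0, 1, N - 1} N).faces :=
      fun hσ hA => Or.inl ⟨⟨hne, hσ⟩, by rwa [hsub]⟩
    rcases h with ⟨j, h1, h2, h | h⟩ | h | h
    · have hA : ¬ (0 ∈ σ ∧ 1 ∈ σ ∧ N - 1 ∈ σ) := fun hA => by have := h 1 hA.2.1; omega
      by_cases hj : j + 1 = N
      · by_cases hNσ : N ∈ σ
        · exact hnew (fun y hy => by have := h y hy; omega) hNσ hA
        · refine hold (Or.inr (Or.inr fun y hy => ?_)) hA
          have h3 : y ≠ N := fun e => hNσ (e ▸ hy)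
          have := h y hy
          omega
      · exact hold (Or.inl ⟨j, h1, by omega, Or.inl h⟩) hA
    · have hA : ¬ (0 ∈ σ ∧ 1 ∈ σ ∧ N - 1 ∈ σ) := fun hA => by have := h 0 hA.1; omega
      by_cases hj : j + 1 = N
      · by_cases hNσ : N ∈ σ
        · exact hnew (fun y hy => by have := h y hy; omega) hNσ hA
        · refine hold (Or.inr (Or.inr fun y hy => ?_)) hA
          have h3 : y ≠ N := fun e => hNσ (e ▸ hy)
          have := h y hy
          omega
      · exact hold (Or.inl ⟨j, h1, by omega, Or.inr h⟩) hA
    · exact hold (Or.inr (Or.inl h)) fun hA => by have := h _ hA.2.2; omega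
    · have hA : ¬ (0 ∈ σ ∧ 1 ∈ σ ∧ N - 1 ∈ σ) := fun hA => by have := h _ hA.2.2; omega
      by_cases hNσ : N ∈ σ
      · exact hnew (fun y hy => by have := h y hy; omega) hNσ hA
      · refine hold (Or.inr (Or.inl fun y hy => ?_)) hA
        have h3 : y ≠ N := fun e => hNσ (e ▸ hy)
        have := h y hy
        omega

theorem stackedSphere_eqvGen {N : ℕ} (hN : 4 ≤ N) :
    Relation.EqvGen StellarStep (stackedSphere N) (simplexBoundary 2) := by
  induction N, hN using Nat.le_induction with
  | base => exact stackedSphere_four ▸ Relation.EqvGen.refl _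
  | succ N hN ih =>
    refine Relation.EqvGen.trans _ _ _ (Relation.EqvGen.symm _ _ (Relation.EqvGen.rel _ _ ?_)) ih
    refine ⟨{0, 1, N - 1}, ⟨⟨0, by simp⟩, Or.inr (Or.inr fun y hy => ?_)⟩, N, ?_,
      (stellar_stackedSphere hN).symm⟩
    · simp only [Finset.mem_insert, Finset.mem_singleton] at hy
      omega
    · rintro ⟨_, ⟨j, h1, h2, h | h⟩ | h | h⟩ <;>
      · have := h N (Finset.mem_singleton_self N)
        omega

/-! ### The combinatorics of cyclic 4-polytopes -/

/-- The cyclic successor of `i` in `0, …, m - 1`. -/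
def cyclicSucc (m i : ℕ) : ℕ := if i + 1 < m then i + 1 else 0

/-- `σ` is covered by two pairs of cyclically adjacent vertices. -/
def IsPairCovered {m : ℕ} (σ : Finset (Fin m)) : Prop :=
  ∃ i j : ℕ, i < m ∧ j < m ∧
    ∀ s ∈ σ, (s : ℕ) = i ∨ (s : ℕ) = cyclicSucc m i ∨ (s : ℕ) = j ∨ (s : ℕ) = cyclicSucc m j

theorem cyclicSucc_lt {m i : ℕ} (hi : i < m) : cyclicSucc m i < m := by
  unfold cyclicSucc
  split_ifs <;> omega

theorem IsPairCovered.card_le {m : ℕ} {σ : Finset (Fin m)} (h : IsPairCovered σ) :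
    σ.card ≤ 4 := by
  obtain ⟨i, j, hi, hj, h⟩ := h
  have hsub : σ ⊆ {⟨i, hi⟩, ⟨_, cyclicSucc_lt hi⟩, ⟨j, hj⟩, ⟨_, cyclicSucc_lt hj⟩} := by
    intro s hs
    simpa only [Finset.mem_insert, Finset.mem_singleton, Fin.ext_iff] using h s hs
  exact (Finset.card_le_card hsub).trans Finset.card_le_four

theorem IsPairCovered.exists_disjoint {m : ℕ} (hm : 5 ≤ m) {σ : Finset (Fin m)}
    (h : IsPairCovered σ) : ∃ i j : ℕ, i < m ∧ j < m ∧ i ≠ j ∧ cyclicSucc m i ≠ j ∧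
      cyclicSucc m j ≠ i ∧ ∀ s ∈ σ, (s : ℕ) = i ∨ (s : ℕ) = cyclicSucc m i ∨ (s : ℕ) = j ∨
        (s : ℕ) = cyclicSucc m j := by
  obtain ⟨i, j, hi, hj, h⟩ := h
  have hi' := cyclicSucc_lt hi
  have hj' := cyclicSucc_lt hj
  by_cases h1 : i = j ∨ cyclicSucc m i = j
  · refine ⟨i, cyclicSucc m (cyclicSucc m i), hi, cyclicSucc_lt hi', ?_, ?_, ?_, fun s hs => ?_⟩
    · unfold cyclicSucc; split_ifs <;> omega
    · unfold cyclicSucc; split_ifs <;> omega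
    · unfold cyclicSucc; split_ifs <;> omega
    · have := h s hs
      rcases h1 with rfl | rfl
      · tauto
      · tauto
  · push Not at h1
    by_cases h2 : cyclicSucc m j = i
    · refine ⟨j, cyclicSucc m i, hj, hi', ?_, ?_, ?_, fun s hs => ?_⟩
      · exact h1.2.symm
      · rw [h2]; unfold cyclicSucc; split_ifs <;> omega
      · subst h2; unfold cyclicSucc; split_ifs <;> omega
      · have := h s hs
        subst h2
        tauto
    · exact ⟨i, j, hi, hj, h1.1, h1.2, h2, h⟩

theorem IsPairCovered.exists_card_eq_four {m : ℕ} (hm : 5 ≤ m) {σ : Finset (Fin m)}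
    (h : IsPairCovered σ) : ∃ τ : Finset (Fin m), IsPairCovered τ ∧ σ ⊆ τ ∧ τ.card = 4 := by
  obtain ⟨i, j, hi, hj, h1, h2, h3, h⟩ := h.exists_disjoint hm
  have e1 : i ≠ cyclicSucc m i := by unfold cyclicSucc; split_ifs <;> omega
  have e2 : j ≠ cyclicSucc m j := by unfold cyclicSucc; split_ifs <;> omega
  have e3 : cyclicSucc m i ≠ cyclicSucc m j := by unfold cyclicSucc; split_ifs <;> omega
  refine ⟨{⟨i, hi⟩, ⟨_, cyclicSucc_lt hi⟩, ⟨j, hj⟩, ⟨_, cyclicSucc_lt hj⟩},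
    ⟨i, j, hi, hj, fun s hs => ?_⟩, fun s hs => ?_, ?_⟩
  · simpa only [Finset.mem_insert, Finset.mem_singleton, Fin.ext_iff] using hs
  · simpa only [Finset.mem_insert, Finset.mem_singleton, Fin.ext_iff] using h s hs
  · rw [Finset.card_insert_of_notMem, Finset.card_insert_of_notMem, Finset.card_pair]
    · simpa [Fin.ext_iff] using e2
    · simpa [Fin.ext_iff] using ⟨h2, e3⟩
    · simpa [Fin.ext_iff] using ⟨e1, h1, h3.symm⟩

/-- For even `m` the cyclic successor changes parity even at the wrap-around, so a pair has only one
vertex of each parity. -/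
theorem card_filter_parity_le {m : ℕ} (hm : Even m) {σ : Finset (Fin m)} (h : IsPairCovered σ)
    (r : ℕ) : (σ.filter fun s : Fin m => (s : ℕ) % 2 = r).card ≤ 2 := by
  obtain ⟨i, j, hi, hj, h⟩ := h
  have key : ∀ i < m, ∃ x : Fin m, ∀ s : Fin m, ((s : ℕ) = i ∨ (s : ℕ) = cyclicSucc m i) →
      (s : ℕ) % 2 = r → s = x := by
    intro i hi
    have hpar : i % 2 ≠ cyclicSucc m i % 2 := by
      rw [Nat.even_iff] at hm
      unfold cyclicSucc
      split_ifs <;> omega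
    by_cases hr : i % 2 = r
    · refine ⟨⟨i, hi⟩, fun s hs hsr => Fin.ext ?_⟩
      rcases hs with hs | hs
      · exact hs
      · rw [hs, ← hr] at hsr
        exact absurd hsr.symm hpar
    · refine ⟨⟨_, cyclicSucc_lt hi⟩, fun s hs hsr => Fin.ext ?_⟩
      rcases hs with hs | hs
      · rw [hs] at hsr
        exact absurd hsr hr
      · exact hs
  obtain ⟨x, hx⟩ := key i hi
  obtain ⟨y, hy⟩ := key j hj
  have hsub : (σ.filter fun s : Fin m => (s : ℕ) % 2 = r) ⊆ {x, y} := by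
    intro s hs
    rw [Finset.mem_filter] at hs
    rw [Finset.mem_insert, Finset.mem_singleton]
    rcases h s hs.1 with h1 | h1 | h1 | h1
    · exact Or.inl (hx s (Or.inl h1) hs.2)
    · exact Or.inl (hx s (Or.inr h1) hs.2)
    · exact Or.inr (hy s (Or.inl h1) hs.2)
    · exact Or.inr (hy s (Or.inr h1) hs.2)
  exact (Finset.card_le_card hsub).trans Finset.card_le_two

/-- The position of `i` when counting cyclically from `u`. -/
def cyclicOffset (m u i : ℕ) : ℕ := if u ≤ i then i - u else i + m - u

theorem cyclicOffset_spec {m u i : ℕ} (hu : u < m) (hi : i < m) :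
    cyclicOffset m u i < m ∧ ((u ≤ i ∧ cyclicOffset m u i + u = i) ∨
      (i < u ∧ cyclicOffset m u i + u = i + m)) := by
  unfold cyclicOffset
  split_ifs <;> omega

/-- Cut the cycle open at `u` and cover greedily: the first pair starts at the first vertex of `σ`,
the second at the first vertex left uncovered. A vertex still uncovered would complete a triple of
pairwise cyclically non-adjacent vertices, which the hypothesis excludes. -/
theorem isPairCovered_of_no_triple {m : ℕ} {σ : Finset (Fin m)} {u : Fin m} (hu : u ∉ σ)
    (h : ∀ a ∈ σ, ∀ b ∈ σ, ∀ c ∈ σ, (a : ℕ) + 1 < b → (b : ℕ) + 1 < c →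
      (a : ℕ) = 0 ∧ (c : ℕ) + 1 = m) : IsPairCovered σ := by
  have hpos : ∀ s ∈ σ, cyclicOffset m u s ≠ 0 := by
    intro s hs h0
    have h1 : s ≠ u := fun e => hu (e ▸ hs)
    have h2 := Fin.val_ne_of_ne h1
    have := cyclicOffset_spec u.2 s.2
    omega
  have hsucc : ∀ a s : Fin m, cyclicOffset m u s = cyclicOffset m u a + 1 →
      (s : ℕ) = cyclicSucc m a := by
    intro a s has
    have h1 := cyclicOffset_spec u.2 s.2
    have h2 := cyclicOffset_spec u.2 a.2
    have h3 := a.2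
    have h4 := s.2
    have h5 := u.2
    unfold cyclicSucc
    split_ifs <;> omega
  have heq : ∀ a s : Fin m, cyclicOffset m u s = cyclicOffset m u a → (s : ℕ) = a := by
    intro a s has
    have h1 := cyclicOffset_spec u.2 s.2
    have h2 := cyclicOffset_spec u.2 a.2
    omega
  rcases σ.eq_empty_or_nonempty with rfl | hne
  · exact ⟨u, u, u.2, u.2, fun s hs => absurd hs (Finset.notMem_empty s)⟩
  obtain ⟨a, ha, hamin⟩ := Finset.exists_min_image σ (fun s : Fin m => cyclicOffset m u s) hne
  rcases (σ.filter fun s : Fin m =>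
      cyclicOffset m u a + 1 < cyclicOffset m u s).eq_empty_or_nonempty with hemp | hne2
  · refine ⟨a, a, a.2, a.2, fun s hs => ?_⟩
    have h1 := hamin s hs
    have h2 : ¬ cyclicOffset m u a + 1 < cyclicOffset m u s := fun hlt =>
      Finset.notMem_empty s (hemp ▸ Finset.mem_filter.mpr ⟨hs, hlt⟩)
    by_cases h3 : cyclicOffset m u s = cyclicOffset m u a
    · exact Or.inl (heq a s h3)
    · exact Or.inr (Or.inl (hsucc a s (by omega)))
  · obtain ⟨b, hb, hbmin⟩ := Finset.exists_min_image _ (fun s : Fin m => cyclicOffset m u s) hne2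
    rw [Finset.mem_filter] at hb
    refine ⟨a, b, a.2, b.2, fun s hs => ?_⟩
    have h1 := hamin s hs
    by_cases h3 : cyclicOffset m u s = cyclicOffset m u a
    · exact Or.inl (heq a s h3)
    by_cases h4 : cyclicOffset m u s = cyclicOffset m u a + 1
    · exact Or.inr (Or.inl (hsucc a s h4))
    have h5 := hbmin s (Finset.mem_filter.mpr ⟨hs, by omega⟩)
    by_cases h6 : cyclicOffset m u s = cyclicOffset m u b
    · exact Or.inr (Or.inr (Or.inl (heq b s h6)))
    by_cases h7 : cyclicOffset m u s = cyclicOffset m u b + 1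
    · exact Or.inr (Or.inr (Or.inr (hsucc b s h7)))
    exfalso
    -- In the natural order the triple is a rotation of its order as seen from `u`, hence three
    -- instances. As `a` has nonzero offset, `u` separates `s` from `a`, so these two are not
    -- adjacent either.
    have k1 := h a ha b hb.1 s hs
    have k2 := h b hb.1 s hs a ha
    have k3 := h s hs a ha b hb.1
    have o1 := cyclicOffset_spec u.2 a.2
    have o2 := cyclicOffset_spec u.2 b.2
    have o3 := cyclicOffset_spec u.2 s.2
    have p1 := hpos a ha
    have l1 := a.2
    have l2 := b.2
    have l3 := s.2
    have l4 := u.2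
    have hb2 := hb.2
    omega

/-! ### Gale's evenness condition -/

/-- A nonempty exposed face is cut out by a supporting functional; subtracting from its maximum
gives an affine function that is nonnegative on the polytope and zero on the face. The face is
proper exactly when this function is positive at some vertex. -/
theorem mem_cyclicBoundary_iff {m : ℕ} (hm : 2 ≤ m) {σ : Finset (Fin m)} :
    σ ∈ (cyclicBoundary m hm).faces ↔ σ.Nonempty ∧ ∃ (c : ℝ) (l : Fin 4 → ℝ),
      (∀ i : Fin m, 0 ≤ c + ∑ j, l j * momentPoint i j) ∧
      (∀ i ∈ σ, c + ∑ j, l j * momentPoint i j = 0) ∧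
      ∃ i : Fin m, 0 < c + ∑ j, l j * momentPoint i j := by
  have hmem : ∀ j : Fin m, momentPoint j ∈ cyclicPolytope m :=
    fun j => subset_convexHull ℝ _ ⟨j, rfl⟩
  constructor
  · rintro ⟨hne, B, hB, hBP, hσ⟩
    refine ⟨hne, ?_⟩
    obtain ⟨i₀, hi₀⟩ := hne
    obtain ⟨l, rfl⟩ := hB ⟨_, hσ i₀ hi₀⟩
    have hl : ∀ p : Fin 4 → ℝ, l p = ∑ j, l (Pi.single j 1) * p j := by
      intro p
      conv_lhs => rw [pi_eq_sum_univ' p]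
      rw [map_sum]
      refine Finset.sum_congr rfl fun j _ => ?_
      rw [map_smul, smul_eq_mul, mul_comm]
    have hval : ∀ p : Fin 4 → ℝ, l (momentPoint i₀) + ∑ j, -l (Pi.single j 1) * p j =
        l (momentPoint i₀) - l p := by
      intro p
      rw [hl p, sub_eq_add_neg, ← Finset.sum_neg_distrib]
      simp only [neg_mul]
    refine ⟨l (momentPoint i₀), fun j => -l (Pi.single j 1), fun i => ?_, fun i hi => ?_, ?_⟩
    · rw [hval]
      exact sub_nonneg.mpr ((hσ i₀ hi₀).2 _ (hmem i))
    · rw [hval]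
      have h1 := (hσ i₀ hi₀).2 _ (hmem i)
      have h2 := (hσ i hi).2 _ (hmem i₀)
      linarith
    · by_contra! hcon
      apply hBP
      have hall : ∀ i : Fin m, l (momentPoint i) = l (momentPoint i₀) := by
        intro i
        have h1 := hcon i
        rw [hval] at h1
        have h2 := (hσ i₀ hi₀).2 _ (hmem i)
        linarith
      have hsub : cyclicPolytope m ⊆ {p | l p = l (momentPoint i₀)} := by
        refine convexHull_min ?_ (convex_hyperplane l.toLinearMap.isLinear _)
        rintro _ ⟨i, rfl⟩
        exact hall i
      refine Set.Subset.antisymm (fun p hp => hp.1) fun p hp => ⟨hp, fun q hq => ?_⟩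
      rw [hsub hq, hsub hp]
  · rintro ⟨hne, c, l, h0, hσ, i₁, hi₁⟩
    let L : StrongDual ℝ (Fin 4 → ℝ) :=
      ∑ j, (-l j) • ContinuousLinearMap.proj (R := ℝ) (φ := fun _ : Fin 4 => ℝ) j
    have hL : ∀ p, L p = -∑ j, l j * p j := by
      intro p
      simp [L, Fin.sum_univ_four]
      ring
    have hle : cyclicPolytope m ⊆ {p | L p ≤ c} := by
      refine convexHull_min ?_ (convex_halfSpace_le L.toLinearMap.isLinear _)
      rintro _ ⟨i, rfl⟩
      change L (momentPoint i) ≤ c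
      rw [hL]
      linarith [h0 i]
    have hface : ∀ i ∈ σ, momentPoint i ∈ L.toExposed (cyclicPolytope m) := by
      intro i hi
      refine ⟨hmem i, fun p hp => ?_⟩
      have h1 : L p ≤ c := hle hp
      have h2 := hσ i hi
      rw [hL (momentPoint i)]
      linarith
    refine ⟨hne, L.toExposed (cyclicPolytope m), ContinuousLinearMap.toExposed.isExposed, ?_, hface⟩
    intro h
    obtain ⟨i, hi⟩ := hne
    have h1 : momentPoint i₁ ∈ L.toExposed (cyclicPolytope m) := h.symm.subset (hmem i₁)
    have h2 := h1.2 _ (hmem i)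
    rw [hL, hL] at h2
    linarith [hσ i hi]

theorem eval_moment {m : ℕ} (c : ℝ) (l : Fin 4 → ℝ) (i : Fin m) :
    c + ∑ j, l j * momentPoint i j = c + l 0 * ((i : ℕ) + 1 : ℝ) + l 1 * ((i : ℕ) + 1 : ℝ) ^ 2 +
      l 2 * ((i : ℕ) + 1 : ℝ) ^ 3 + l 3 * ((i : ℕ) + 1 : ℝ) ^ 4 := by
  simp [Fin.sum_univ_four, momentPoint]
  ring

theorem quadratic_eq_zero_of_three_roots {r₀ r₁ r₂ a b c : ℝ} (hab : a ≠ b) (hac : a ≠ c)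
    (hbc : b ≠ c) (ha : r₀ + r₁ * a + r₂ * a ^ 2 = 0) (hb : r₀ + r₁ * b + r₂ * b ^ 2 = 0)
    (hc : r₀ + r₁ * c + r₂ * c ^ 2 = 0) (t : ℝ) : r₀ + r₁ * t + r₂ * t ^ 2 = 0 := by
  have h1 : r₁ + r₂ * (a + b) = 0 := by
    apply mul_left_cancel₀ (sub_ne_zero.mpr hab)
    linear_combination ha - hb
  have h2 : r₁ + r₂ * (a + c) = 0 := by
    apply mul_left_cancel₀ (sub_ne_zero.mpr hac)
    linear_combination ha - hc
  have h3 : r₂ = 0 := by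
    apply mul_left_cancel₀ (sub_ne_zero.mpr hbc)
    linear_combination h1 - h2
  subst h3
  have h4 : r₁ = 0 := by linarith
  subst h4
  linarith

theorem quartic_eq_mul_of_three_roots {c₀ c₁ c₂ c₃ c₄ a b c : ℝ} (hab : a ≠ b) (hac : a ≠ c)
    (hbc : b ≠ c) (ha : c₀ + c₁ * a + c₂ * a ^ 2 + c₃ * a ^ 3 + c₄ * a ^ 4 = 0)
    (hb : c₀ + c₁ * b + c₂ * b ^ 2 + c₃ * b ^ 3 + c₄ * b ^ 4 = 0)
    (hc : c₀ + c₁ * c + c₂ * c ^ 2 + c₃ * c ^ 3 + c₄ * c ^ 4 = 0) :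
    ∃ β, ∀ t, c₀ + c₁ * t + c₂ * t ^ 2 + c₃ * t ^ 3 + c₄ * t ^ 4 =
      (t - a) * (t - b) * (t - c) * (c₄ * t + β) := by
  -- Division with remainder by the cubic; the quadratic remainder has three roots. The slope of the
  -- linear quotient is the leading coefficient `c₄`, whose sign is studied next.
  have h : ∀ t, c₀ + c₁ * t + c₂ * t ^ 2 + c₃ * t ^ 3 + c₄ * t ^ 4 =
      (t - a) * (t - b) * (t - c) * (c₄ * t + (c₃ + c₄ * (a + b + c))) +
      ((c₀ + (c₃ + c₄ * (a + b + c)) * (a * b * c)) +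
        (c₁ - (c₃ + c₄ * (a + b + c)) * (a * b + a * c + b * c) + c₄ * (a * b * c)) * t +
        (c₂ - c₄ * (a * b + a * c + b * c) + (c₃ + c₄ * (a + b + c)) * (a + b + c)) * t ^ 2) := by
    intro t
    ring
  refine ⟨c₃ + c₄ * (a + b + c), fun t => ?_⟩
  rw [h] at ha hb hc ⊢
  rw [quadratic_eq_zero_of_three_roots hab hac hbc (by linarith) (by linarith) (by linarith),
    add_zero]

/-- A polynomial of degree at most four that is nonnegative at `1, …, m` and vanishes at three
pairwise cyclically non-adjacent ones of these points vanishes at all of them. -/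
theorem quartic_eq_zero {m a b c : ℕ} (hab : a + 1 < b) (hbc : b + 1 < c) (hc : c < m)
    (hac : ¬ (a = 0 ∧ c + 1 = m)) {c₀ c₁ c₂ c₃ c₄ : ℝ} {P : ℕ → ℝ}
    (hP : ∀ i, P i = c₀ + c₁ * ((i : ℝ) + 1) + c₂ * ((i : ℝ) + 1) ^ 2 + c₃ * ((i : ℝ) + 1) ^ 3 +
      c₄ * ((i : ℝ) + 1) ^ 4)
    (h0 : ∀ i < m, 0 ≤ P i) (ha : P a = 0) (hb : P b = 0) (hc0 : P c = 0) (i : ℕ) : P i = 0 := by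
  have hab' : (a : ℝ) + 1 < b := by exact_mod_cast hab
  have hbc' : (b : ℝ) + 1 < c := by exact_mod_cast hbc
  rw [hP] at ha hb hc0
  obtain ⟨β, hβ⟩ := quartic_eq_mul_of_three_roots (by linarith : (a : ℝ) + 1 ≠ b + 1)
    (by linarith : (a : ℝ) + 1 ≠ c + 1) (by linarith : (b : ℝ) + 1 ≠ c + 1) ha hb hc0
  have hval : ∀ i : ℕ, P i = ((i : ℝ) - a) * (i - b) * (i - c) * (c₄ * (i + 1) + β) := by
    intro i
    rw [hP, hβ]
    ring
  -- Index `i` stands for the point `t = i + 1`. Directly after `a` the cubic factor is positive and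
  -- directly after `b` it is negative, so the linear factor does not increase from one to the
  -- other.
  have e1 : 0 ≤ c₄ * ((a : ℝ) + 1 + 1) + β := by
    have h1 := h0 (a + 1) (by omega)
    rw [hval] at h1
    push_cast at h1
    have h2 : 0 < ((a : ℝ) + 1 - a) * (a + 1 - b) * (a + 1 - c) := by
      rw [add_sub_cancel_left, one_mul]
      exact mul_pos_of_neg_of_neg (by linarith) (by linarith)
    exact nonneg_of_mul_nonneg_right h1 h2
  have e2 : c₄ * ((b : ℝ) + 1 + 1) + β ≤ 0 := by
    have h1 := h0 (b + 1) (by omega)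
    rw [hval] at h1
    push_cast at h1
    have h2 : ((b : ℝ) + 1 - a) * (b + 1 - b) * (b + 1 - c) < 0 := by
      rw [add_sub_cancel_left, mul_one]
      exact mul_neg_of_pos_of_neg (by linarith) (by linarith)
    by_contra! h3
    exact absurd h1 (not_le.mpr (mul_neg_of_neg_of_pos h2 h3))
  -- Since `a` and `c` are not cyclically adjacent, there is a further point directly after `c` or
  -- directly before `a`; the sign of the cubic there forces the opposite slope, so the linear
  -- factor vanishes identically.
  have e3 : 0 ≤ c₄ := by
    by_cases ha0 : a = 0
    · have h1 := h0 (c + 1) (by omega)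
      rw [hval] at h1
      push_cast at h1
      have h2 : 0 < ((c : ℝ) + 1 - a) * (c + 1 - b) * (c + 1 - c) := by
        rw [add_sub_cancel_left, mul_one]
        exact mul_pos (by linarith) (by linarith)
      have h3 := nonneg_of_mul_nonneg_right h1 h2
      have h4 : 0 ≤ c₄ * ((c : ℝ) - b) := by linarith
      exact nonneg_of_mul_nonneg_left h4 (by linarith)
    · obtain ⟨d, rfl⟩ := Nat.exists_eq_succ_of_ne_zero ha0
      have h1 := h0 d (by omega)
      rw [hval] at h1
      push_cast at *
      have h2 : ((d : ℝ) - (d + 1)) * (d - b) * (d - c) < 0 := by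
        rw [mul_assoc]
        exact mul_neg_of_neg_of_pos (by linarith)
          (mul_pos_of_neg_of_neg (by linarith) (by linarith))
      have h3 : c₄ * ((d : ℝ) + 1) + β ≤ 0 := by
        by_contra! h3
        exact absurd h1 (not_le.mpr (mul_neg_of_neg_of_pos h2 h3))
      linarith
  have e4 : c₄ = 0 := by
    have h4 : c₄ * ((b : ℝ) - a) ≤ 0 := by linarith
    have h5 : c₄ ≤ 0 := by
      by_contra! h6
      exact absurd h4 (not_le.mpr (mul_pos h6 (by linarith)))
    linarith
  subst e4
  have e5 : β = 0 := by linarith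
  rw [hval, e5]
  ring

/-- A quadratic polynomial that is nonnegative at `1, …, m` and vanishes exactly at two given
cyclically adjacent ones of these points. -/
theorem exists_quadratic {m i : ℕ} (hi : i < m) : ∃ q₀ q₁ q₂ : ℝ, ∀ s : ℕ, s < m →
    0 ≤ q₀ + q₁ * ((s : ℝ) + 1) + q₂ * ((s : ℝ) + 1) ^ 2 ∧
    (q₀ + q₁ * ((s : ℝ) + 1) + q₂ * ((s : ℝ) + 1) ^ 2 = 0 ↔ s = i ∨ s = cyclicSucc m i) := by
  unfold cyclicSucc
  split_ifs with h
  -- In `t = s + 1` this is `(t - (i + 1))(t - (i + 2))`; no integer lies strictly between its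
  -- roots.
  · refine ⟨(i + 1) * (i + 2), -(2 * i + 3), 1, fun s _ => ?_⟩
    have he : ((i : ℝ) + 1) * (i + 2) + -(2 * i + 3) * ((s : ℝ) + 1) + 1 * ((s : ℝ) + 1) ^ 2 =
        (s - i) * (s - (i + 1)) := by ring
    rw [he, mul_eq_zero, sub_eq_zero, sub_eq_zero]
    refine ⟨?_, or_congr (by exact_mod_cast Iff.rfl) (by exact_mod_cast Iff.rfl)⟩
    rcases Nat.lt_or_ge i s with h1 | h1
    · have : (i : ℝ) + 1 ≤ s := by exact_mod_cast h1
      exact mul_nonneg (by linarith) (by linarith)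
    · have : (s : ℝ) ≤ i := by exact_mod_cast h1
      exact mul_nonneg_of_nonpos_of_nonpos (by linarith) (by linarith)
  -- Wrap-around pair, with `i + 1 = m`: here `(m - t)(t - 1)` is nonnegative because all points lie
  -- between the roots.
  · refine ⟨-(i + 1), i + 2, -1, fun s hs => ?_⟩
    have he : -((i : ℝ) + 1) + (i + 2) * ((s : ℝ) + 1) + -1 * ((s : ℝ) + 1) ^ 2 =
        (i - s) * s := by ring
    rw [he, mul_eq_zero, sub_eq_zero]
    refine ⟨?_, or_congr ⟨fun h => by exact_mod_cast h.symm, fun h => by exact_mod_cast h.symm⟩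
      (by exact_mod_cast Iff.rfl)⟩
    have : (s : ℝ) ≤ i := by exact_mod_cast (by omega : s ≤ i)
    exact mul_nonneg (by linarith) (Nat.cast_nonneg s)

/-- Gale's evenness condition for faces of the cyclic 4-polytope. -/
theorem mem_cyclicBoundary_iff_isPairCovered {m : ℕ} (hm : 2 ≤ m) (hm5 : 5 ≤ m)
    {σ : Finset (Fin m)} :
    σ ∈ (cyclicBoundary m hm).faces ↔ σ.Nonempty ∧ IsPairCovered σ := by
  rw [mem_cyclicBoundary_iff]
  refine and_congr_right fun _ => ?_
  simp only [eval_moment]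
  constructor
  · rintro ⟨c, l, h0, hσ, u, hu⟩
    have huσ : u ∉ σ := fun h => hu.ne' (hσ u h)
    refine isPairCovered_of_no_triple huσ fun x hx y hy z hz hxy hyz => ?_
    by_contra hxz
    have := quartic_eq_zero hxy hyz z.2 hxz (fun i => rfl) (fun i hi => h0 ⟨i, hi⟩)
      (hσ x hx) (hσ y hy) (hσ z hz) u
    exact hu.ne' this
  · rintro ⟨i, j, hi, hj, hcov⟩
    -- The supporting functional is read off the coefficients of a product of two quadratics, one
    -- for each pair.
    obtain ⟨q₀, q₁, q₂, hq⟩ := exists_quadratic hi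
    obtain ⟨r₀, r₁, r₂, hr⟩ := exists_quadratic hj
    have hprod : ∀ t : ℝ, q₀ * r₀ + (q₀ * r₁ + q₁ * r₀) * t +
        (q₀ * r₂ + q₁ * r₁ + q₂ * r₀) * t ^ 2 + (q₁ * r₂ + q₂ * r₁) * t ^ 3 + q₂ * r₂ * t ^ 4 =
        (q₀ + q₁ * t + q₂ * t ^ 2) * (r₀ + r₁ * t + r₂ * t ^ 2) := fun t => by ring
    refine ⟨q₀ * r₀, ![q₀ * r₁ + q₁ * r₀, q₀ * r₂ + q₁ * r₁ + q₂ * r₀, q₁ * r₂ + q₂ * r₁,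
      q₂ * r₂], ?_⟩
    simp only [Matrix.cons_val_zero, Matrix.cons_val_one, Matrix.cons_val, hprod]
    refine ⟨fun s => mul_nonneg (hq s s.2).1 (hr s s.2).1, fun s hs => ?_, ?_⟩
    · rw [mul_eq_zero, (hq s s.2).2, (hr s s.2).2, or_assoc]
      exact hcov s hs
    -- Two pairs cannot cover all of `0, …, 4`, so with at least five vertices the face is proper.
    · obtain ⟨s, hs, h1, h2⟩ : ∃ s < m, ¬ (s = i ∨ s = cyclicSucc m i) ∧
          ¬ (s = j ∨ s = cyclicSucc m j) := by
        by_contra! hcon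
        have k0 := hcon 0 (by omega)
        have k1 := hcon 1 (by omega)
        have k2 := hcon 2 (by omega)
        have k3 := hcon 3 (by omega)
        have k4 := hcon 4 (by omega)
        omega
      exact ⟨⟨s, hs⟩, mul_pos ((hq s hs).1.lt_of_ne' fun h => h1 ((hq s hs).2.mp h))
        ((hr s hs).1.lt_of_ne' fun h => h2 ((hr s hs).2.mp h))⟩

/-! ### Rotations of the cycle and vertex links of the cyclic polytope -/

theorem cyclicOffset_lt {m u i : ℕ} (hu : u < m) (hi : i < m) : cyclicOffset m u i < m := by
  have := cyclicOffset_spec hu hi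
  omega

theorem exists_cyclicOffset_eq {m u k : ℕ} (hu : u < m) (hk : k < m) :
    ∃ i < m, cyclicOffset m u i = k := by
  by_cases h : u + k < m
  · exact ⟨u + k, h, by have := cyclicOffset_spec hu h; omega⟩
  · have h2 : u + k - m < m := by omega
    exact ⟨u + k - m, h2, by have := cyclicOffset_spec hu h2; omega⟩

theorem cyclicOffset_inj {m u i j : ℕ} (hu : u < m) (hi : i < m) (hj : j < m) :
    cyclicOffset m u i = cyclicOffset m u j ↔ i = j := by
  have h1 := cyclicOffset_spec hu hi
  have h2 := cyclicOffset_spec hu hj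
  omega

theorem cyclicOffset_cyclicSucc {m u i : ℕ} (hu : u < m) (hi : i < m) :
    cyclicOffset m u (cyclicSucc m i) = cyclicSucc m (cyclicOffset m u i) := by
  have h1 := cyclicOffset_spec hu hi
  have h2 := cyclicOffset_spec hu (cyclicSucc_lt hi)
  unfold cyclicSucc at h2 ⊢
  split_ifs at h2 ⊢ <;> omega

/-- Rotations of the vertex set preserve coverings by adjacent pairs. -/
theorem isPairCovered_iff_cyclicOffset {m : ℕ} (u : Fin m) {σ : Finset (Fin m)} :
    IsPairCovered σ ↔ ∃ p q : ℕ, p < m ∧ q < m ∧ ∀ s ∈ σ, cyclicOffset m u s = p ∨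
      cyclicOffset m u s = cyclicSucc m p ∨ cyclicOffset m u s = q ∨
      cyclicOffset m u s = cyclicSucc m q := by
  have key : ∀ i j, i < m → j < m → ∀ s : Fin m,
      ((s : ℕ) = i ∨ (s : ℕ) = cyclicSucc m i ∨ (s : ℕ) = j ∨ (s : ℕ) = cyclicSucc m j) ↔
      (cyclicOffset m u s = cyclicOffset m u i ∨
        cyclicOffset m u s = cyclicSucc m (cyclicOffset m u i) ∨
        cyclicOffset m u s = cyclicOffset m u j ∨
        cyclicOffset m u s = cyclicSucc m (cyclicOffset m u j)) := by
    intro i j hi hj s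
    rw [← cyclicOffset_cyclicSucc u.2 hi, ← cyclicOffset_cyclicSucc u.2 hj,
      cyclicOffset_inj u.2 s.2 hi, cyclicOffset_inj u.2 s.2 hj,
      cyclicOffset_inj u.2 s.2 (cyclicSucc_lt hi), cyclicOffset_inj u.2 s.2 (cyclicSucc_lt hj)]
  constructor
  · rintro ⟨i, j, hi, hj, h⟩
    exact ⟨_, _, cyclicOffset_lt u.2 hi, cyclicOffset_lt u.2 hj,
      fun s hs => (key i j hi hj s).mp (h s hs)⟩
  · rintro ⟨p, q, hp, hq, h⟩
    obtain ⟨i, hi, rfl⟩ := exists_cyclicOffset_eq u.2 hp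
    obtain ⟨j, hj, rfl⟩ := exists_cyclicOffset_eq u.2 hq
    exact ⟨i, j, hi, hj, fun s hs => (key i j hi hj s).mpr (h s hs)⟩

/-- The relabelling of positions that turns the link of a vertex of the cyclic 4-polytope into a
stacked sphere. -/
def linkLabel (m k : ℕ) : ℕ := if k = 1 then 0 else if k + 1 = m then 1 else if k = 0 then m else k

theorem linkLabel_spec {m k : ℕ} (hm : 5 ≤ m) (hk : k < m) :
    (k = 1 ∧ linkLabel m k = 0) ∨ (k + 1 = m ∧ linkLabel m k = 1) ∨ (k = 0 ∧ linkLabel m k = m) ∨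
      (2 ≤ k ∧ k + 2 ≤ m ∧ linkLabel m k = k) := by
  unfold linkLabel
  split_ifs <;> omega

/-- In a face containing `v`, one pair covers `v` and so at most one other vertex, a cyclic
neighbour. The neighbours, at offsets `1` and `m - 1`, become the apexes `0` and `1`, and the other
pair becomes `j, j + 1`. If that pair meets a neighbour or `v`, the end triangles `0, 1, 2` and `0,
1, m - 2` take over. The vertex `v` itself gets the unused label `m`, which keeps the relabelling
injective. -/
theorem map_link_cyclicBoundary {m : ℕ} (hm : 2 ≤ m) (hm5 : 5 ≤ m) (v : Fin m) :
    (link (cyclicBoundary m hm).toPreAbstractSimplicialComplex v).map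
      (fun s => linkLabel m (cyclicOffset m v s)) = stackedSphere (m - 1) := by
  have hv0 : cyclicOffset m v v = 0 := by have := cyclicOffset_spec v.2 v.2; omega
  have hD : ∀ s : Fin m, s ≠ v → cyclicOffset m v s ≠ 0 := fun s hs h =>
    hs (Fin.ext ((cyclicOffset_inj v.2 s.2 v.2).mp (h.trans hv0.symm)))
  have hsucc : ∀ p < m, (p + 1 < m ∧ cyclicSucc m p = p + 1) ∨
      (p + 1 = m ∧ cyclicSucc m p = 0) := by
    intro p hp
    unfold cyclicSucc
    split_ifs <;> omega
  ext ρ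
  constructor
  · rintro ⟨τ, ⟨hne, hv, hτ⟩, rfl⟩
    refine ⟨hne.image _, ?_⟩
    have hcov := ((mem_cyclicBoundary_iff_isPairCovered hm hm5).mp hτ).2
    rw [isPairCovered_iff_cyclicOffset v] at hcov
    obtain ⟨p, q, hp, hq, hpq⟩ := hcov
    -- Here `e` is the offset of the neighbour paired with `v`, and `k, k + 1` is the second pair;
    -- offset zero does not occur in `τ`.
    have key : ∀ e k, (e = 1 ∨ e + 1 = m) → k < m → (∀ s ∈ τ, cyclicOffset m v s = e ∨
        cyclicOffset m v s = k ∨ cyclicOffset m v s = k + 1) →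
        InStackedTriangle (m - 1) (τ.image fun s : Fin m => linkLabel m (cyclicOffset m v s)) := by
      intro e k he hk h
      have hy : ∀ y ∈ τ.image (fun s : Fin m => linkLabel m (cyclicOffset m v s)),
          ∃ d, 0 < d ∧ d < m ∧ y = linkLabel m d ∧ (d = e ∨ d = k ∨ d = k + 1) := by
        intro y hy
        obtain ⟨s, hs, rfl⟩ := Finset.mem_image.mp hy
        exact ⟨_, Nat.pos_of_ne_zero (hD s fun e => hv (e ▸ hs)), cyclicOffset_lt v.2 s.2, rfl,
          h s hs⟩
      by_cases h1 : k ≤ 1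
      · refine Or.inr (Or.inl fun y hy' => ?_)
        obtain ⟨d, hd0, hdm, rfl, hd⟩ := hy y hy'
        have := linkLabel_spec hm5 hdm
        omega
      by_cases h2 : k + 2 < m
      · refine Or.inl ⟨k, by omega, by omega, ?_⟩
        rcases he with he | he
        · refine Or.inl fun y hy' => ?_
          obtain ⟨d, hd0, hdm, rfl, hd⟩ := hy y hy'
          have := linkLabel_spec hm5 hdm
          omega
        · refine Or.inr fun y hy' => ?_
          obtain ⟨d, hd0, hdm, rfl, hd⟩ := hy y hy'
          have := linkLabel_spec hm5 hdm
          omega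
      · refine Or.inr (Or.inr fun y hy' => ?_)
        obtain ⟨d, hd0, hdm, rfl, hd⟩ := hy y hy'
        have := linkLabel_spec hm5 hdm
        omega
    have h0 := hpq v (Finset.mem_insert_self v τ)
    rw [hv0] at h0
    have hp' := hsucc p hp
    have hq' := hsucc q hq
    have hτd : ∀ s ∈ τ, cyclicOffset m v s ≠ 0 ∧ (cyclicOffset m v s = p ∨
      cyclicOffset m v s = cyclicSucc m p ∨ cyclicOffset m v s = q ∨
      cyclicOffset m v s = cyclicSucc m q) := fun s hs =>
      ⟨hD s fun e => hv (e ▸ hs), hpq s (Finset.mem_insert_of_mem hs)⟩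
    rcases h0 with h0 | h0 | h0 | h0
    · exact key 1 q (Or.inl rfl) hq fun s hs => by have := hτd s hs; omega
    · exact key p q (Or.inr (by omega)) hq fun s hs => by have := hτd s hs; omega
    · exact key 1 p (Or.inl rfl) hp fun s hs => by have := hτd s hs; omega
    · exact key q p (Or.inr (by omega)) hp fun s hs => by have := hτd s hs; omega
  · rintro ⟨hne, hρ⟩
    have hlt : ∀ y ∈ ρ, y + 1 < m := by
      intro y hy
      rcases hρ with ⟨j, h1, h2, h | h⟩ | h | h <;>
      · have := h y hy
        omega
    have himg : (Finset.univ.filter fun s : Fin m =>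
        linkLabel m (cyclicOffset m v s) ∈ ρ).image
        (fun s : Fin m => linkLabel m (cyclicOffset m v s)) = ρ := by
      ext y
      simp only [Finset.mem_image, Finset.mem_filter, Finset.mem_univ, true_and]
      constructor
      · rintro ⟨s, hs, rfl⟩
        exact hs
      · intro hy
        have hym := hlt y hy
        obtain ⟨k, hk, hky⟩ : ∃ k < m, linkLabel m k = y := by
          by_cases h0 : y = 0
          · exact ⟨1, by omega, by simp [linkLabel, h0]⟩
          by_cases h1 : y = 1
          · refine ⟨m - 1, by omega, ?_⟩
            have := linkLabel_spec hm5 (by omega : m - 1 < m)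
            omega
          · refine ⟨y, by omega, ?_⟩
            have := linkLabel_spec hm5 (by omega : y < m)
            omega
        obtain ⟨s, hs, rfl⟩ := exists_cyclicOffset_eq v.2 hk
        exact ⟨⟨s, hs⟩, hky.symm ▸ hy, hky⟩
    refine ⟨_, ⟨?_, ?_, ?_⟩, himg⟩
    · exact Finset.image_nonempty.mp (himg.symm ▸ hne)
    · rw [Finset.mem_filter, hv0]
      rintro ⟨-, h⟩
      have h1 := hlt _ h
      have h2 := linkLabel_spec hm5 (by omega : 0 < m)
      omega
    · rw [mem_cyclicBoundary_iff_isPairCovered hm hm5]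
      refine ⟨Finset.insert_nonempty _ _, (isPairCovered_iff_cyclicOffset v).mpr ?_⟩
      have key : ∀ p q, p < m → q < m → (p = 0 ∨ p + 1 = m) →
          (∀ d < m, linkLabel m d ∈ ρ → d = p ∨ d = cyclicSucc m p ∨ d = q ∨ d = cyclicSucc m q) →
          ∃ p q : ℕ, p < m ∧ q < m ∧ ∀ s ∈ insert v (Finset.univ.filter fun s : Fin m =>
            linkLabel m (cyclicOffset m v s) ∈ ρ), cyclicOffset m v s = p ∨
            cyclicOffset m v s = cyclicSucc m p ∨ cyclicOffset m v s = q ∨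
            cyclicOffset m v s = cyclicSucc m q := by
        intro p q hp hq hp0 h
        refine ⟨p, q, hp, hq, fun s hs => ?_⟩
        rcases Finset.mem_insert.mp hs with rfl | hs
        · rw [hv0]
          have := hsucc p hp
          omega
        · exact h _ (cyclicOffset_lt v.2 s.2) (Finset.mem_filter.mp hs).2
      rcases hρ with ⟨j, h1, h2, h | h⟩ | h | h
      · refine key 0 j (by omega) (by omega) (Or.inl rfl) fun d hd hdρ => ?_
        have e1 := linkLabel_spec hm5 hd
        have e2 := h _ hdρ
        have e3 := hsucc 0 (by omega)
        have e4 := hsucc j (by omega)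
        omega
      · refine key (m - 1) j (by omega) (by omega) (Or.inr (by omega)) fun d hd hdρ => ?_
        have e1 := linkLabel_spec hm5 hd
        have e2 := h _ hdρ
        have e4 := hsucc j (by omega)
        omega
      · refine key (m - 1) 1 (by omega) (by omega) (Or.inr (by omega)) fun d hd hdρ => ?_
        have e1 := linkLabel_spec hm5 hd
        have e2 := h _ hdρ
        have e4 := hsucc 1 (by omega)
        omega
      · refine key 0 (m - 2) (by omega) (by omega) (Or.inl rfl) fun d hd hdρ => ?_
        have e1 := linkLabel_spec hm5 hd
        have e2 := h _ hdρ
        have e3 := hsucc 0 (by omega)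
        have e4 := hsucc (m - 2) (by omega)
        omega

theorem isCombinatorialSphere_link_cyclicBoundary {m : ℕ} (hm : 2 ≤ m) (hm5 : 5 ≤ m) (v : Fin m) :
    IsCombinatorialSphere 2 (link (cyclicBoundary m hm).toPreAbstractSimplicialComplex v) := by
  refine ⟨fun s => linkLabel m (cyclicOffset m v s), fun s t hst => Fin.ext ?_, ?_⟩
  · have h1 := linkLabel_spec hm5 (cyclicOffset_lt v.2 s.2)
    have h2 := linkLabel_spec hm5 (cyclicOffset_lt v.2 t.2)
    simp only at hst
    exact (cyclicOffset_inj v.2 s.2 t.2).mp (by omega)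
  · rw [map_link_cyclicBoundary hm hm5]
    exact stackedSphere_eqvGen (by omega)

theorem isCombinatorial3Manifold_cyclicBoundary {m : ℕ} (hm : 2 ≤ m) (hm5 : 5 ≤ m) :
    IsCombinatorial3Manifold (cyclicBoundary m hm) := by
  refine ⟨⟨{⟨0, by omega⟩}, (cyclicBoundary m hm).singleton_mem _⟩, fun σ hσ => ?_,
    isCombinatorialSphere_link_cyclicBoundary hm hm5⟩
  have hcov := ((mem_cyclicBoundary_iff_isPairCovered hm hm5).mp hσ).2
  obtain ⟨τ, hτ, hsub, hc⟩ := hcov.exists_card_eq_four hm5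
  exact ⟨hcov.card_le, τ, (mem_cyclicBoundary_iff_isPairCovered hm hm5).mpr
    ⟨Finset.card_pos.mp (by omega), hτ⟩, hsub, hc⟩

theorem isNeighborly_cyclicBoundary {m : ℕ} (hm : 2 ≤ m) (hm5 : 5 ≤ m) :
    IsNeighborly 2 (cyclicBoundary m hm) := by
  have hc : ∀ k, 0 < k → (∀ σ : Finset (Fin m), σ.card = k → IsPairCovered σ) →
      faceCount (cyclicBoundary m hm) k = m.choose k := by
    intro k hk h
    have : {σ : Finset (Fin m) | σ ∈ (cyclicBoundary m hm).faces ∧ σ.card = k} =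
        ((Finset.univ.powersetCard k : Finset (Finset (Fin m))) : Set (Finset (Fin m))) := by
      ext σ
      simp only [Set.mem_ofPred_eq, Finset.mem_coe, Finset.mem_powersetCard, Finset.subset_univ,
        true_and, and_iff_right_iff_imp]
      intro hσ
      exact (mem_cyclicBoundary_iff_isPairCovered hm hm5).mpr
        ⟨Finset.card_pos.mp (by omega), h σ hσ⟩
    rw [faceCount, this, Set.ncard_coe_finset, Finset.card_powersetCard, Finset.card_univ,
      Fintype.card_fin]
  rw [IsNeighborly, hc 2 (by omega), hc 1 (by omega), Nat.choose_one_right]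
  · intro σ hσ
    obtain ⟨a, rfl⟩ := Finset.card_eq_one.mp hσ
    exact ⟨a, a, a.2, a.2, fun s hs => Or.inl (by rw [Finset.mem_singleton.mp hs])⟩
  · intro σ hσ
    obtain ⟨a, b, -, rfl⟩ := Finset.card_eq_two.mp hσ
    refine ⟨a, b, a.2, b.2, fun s hs => ?_⟩
    rcases Finset.mem_insert.mp hs with rfl | hs
    · exact Or.inl rfl
    · exact Or.inr (Or.inr (Or.inl (by rw [Finset.mem_singleton.mp hs])))

/-! ### The slicing of the cyclic polytope by parity -/

theorem mem_oddLabels {m : ℕ} {i : Fin m} : i ∈ oddLabels m ↔ (i : ℕ) % 2 = 0 := by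
  simp only [oddLabels, Finset.mem_filter, Finset.mem_univ, true_and, Nat.odd_iff]
  omega

theorem mem_evenLabels {m : ℕ} {i : Fin m} : i ∈ evenLabels m ↔ (i : ℕ) % 2 = 1 := by
  simp only [evenLabels, Finset.mem_filter, Finset.mem_univ, true_and, Nat.even_iff]
  omega

theorem disjoint_oddLabels_evenLabels (m : ℕ) : Disjoint (oddLabels m) (evenLabels m) :=
  Finset.disjoint_left.mpr fun i h1 h2 => by
    rw [mem_oddLabels] at h1
    rw [mem_evenLabels] at h2
    omega

theorem oddLabels_union_evenLabels (m : ℕ) : oddLabels m ∪ evenLabels m = Finset.univ := by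
  ext i
  simp only [Finset.mem_union, mem_oddLabels, mem_evenLabels, Finset.mem_univ, iff_true]
  omega

theorem card_oddLabels (k : ℕ) : (oddLabels (2 * k)).card = (evenLabels (2 * k)).card := by
  refine Finset.card_bij (fun i hi => ⟨i + 1, ?_⟩) (fun i hi => ?_) (fun i _ j _ hij => ?_)
    fun j hj => ?_
  · have := mem_oddLabels.mp hi
    have := i.2
    omega
  · have := mem_oddLabels.mp hi
    rw [mem_evenLabels]
    simp only
    omega
  · rw [Fin.mk.injEq] at hij
    exact Fin.ext (by omega)
  · have h1 := mem_evenLabels.mp hj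
    have h2 := j.2
    exact ⟨⟨j - 1, by omega⟩, mem_oddLabels.mpr (by simp only; omega),
      Fin.ext (by simp only; omega)⟩

theorem exists_defines_cyclicBoundary {m : ℕ} (hm : 2 ≤ m) :
    ∃ (F : (Fin m → ℝ) → ℝ) (x : ℝ),
      Defines (cyclicBoundary m hm) (oddLabels m) (evenLabels m) F x := by
  -- Signs by parity of the label separate the two classes at level zero, and distinct absolute
  -- values make the function injective.
  let f : Fin m → ℝ := fun i => (-1) ^ ((i : ℕ) + 1) * ((i : ℕ) + 1 : ℝ)
  have hf : ∀ v, vertexValue (fun p : Fin m → ℝ => ∑ v, p v * f v) v = f v := by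
    intro v
    simp [vertexValue, Pi.single_apply]
  have hpos : ∀ v : Fin m, (0 : ℝ) < (v : ℕ) + 1 := fun v => by positivity
  have hodd : ∀ v ∈ oddLabels m, f v = -((v : ℕ) + 1 : ℝ) := by
    intro v hv
    have : Odd ((v : ℕ) + 1) := (Finset.mem_filter.mp hv).2
    simp [f, this.neg_one_pow]
  have heven : ∀ v ∈ evenLabels m, f v = ((v : ℕ) + 1 : ℝ) := by
    intro v hv
    have : Even ((v : ℕ) + 1) := (Finset.mem_filter.mp hv).2
    simp [f, this.neg_one_pow]
  refine ⟨fun p => ∑ v, p v * f v, 0, ⟨fun v w hvw => ?_, fun σ _ p _ => by simp only [hf]⟩,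
    fun v hv => ?_, fun v hv => ?_⟩
  · rw [hf, hf] at hvw
    have h1 : |f v| = |f w| := by rw [hvw]
    simp only [f, abs_mul, abs_pow, abs_neg, abs_one, one_pow, one_mul, abs_of_pos (hpos _)] at h1
    exact Fin.ext (by exact_mod_cast add_right_cancel h1)
  · rw [hf, hodd v hv]
    linarith [hpos v]
  · rw [hf, heven v hv]
    exact hpos v

/-- Every tetrahedron has at most two vertices of each parity, hence is split 2-2. So `q` and the
number of mixed tetrahedra both equal `k(2k - 3)`, and `χ = k² - k(2k - 3)`. -/
theorem genus_and_quadCount_cyclicBoundary {k : ℕ} (hk : 3 ≤ k) (hm : 2 ≤ 2 * k)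
    {F : (Fin (2 * k) → ℝ) → ℝ} {x : ℝ}
    (h : Defines (cyclicBoundary (2 * k) hm) (oddLabels (2 * k)) (evenLabels (2 * k)) F x) :
    genus (cyclicBoundary (2 * k) hm) F x = ((k - 1).choose 2 : ℝ) ∧
      (quadCount (cyclicBoundary (2 * k) hm) F x : ℝ) =
        4 * genus (cyclicBoundary (2 * k) hm) F x + 3 * ((2 * k : ℕ) : ℝ) / 2 - 4 := by
  classical
  have hm5 : 5 ≤ 2 * k := by omega
  have hM := isCombinatorial3Manifold_cyclicBoundary hm hm5
  have hN := isNeighborly_cyclicBoundary hm hm5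
  have hV := oddLabels_union_evenLabels (2 * k)
  have hd := disjoint_oddLabels_evenLabels (2 * k)
  have hcard : (oddLabels (2 * k)).card = k ∧ (evenLabels (2 * k)).card = k := by
    have h1 := card_oddLabels k
    have h2 := Finset.card_union_of_disjoint hd
    rw [hV, Finset.card_univ, Fintype.card_fin] at h2
    omega
  have hquad : ∀ σ ∈ kFaces (cyclicBoundary (2 * k) hm) 4,
      (σ.filter (· ∈ oddLabels (2 * k))).card = 2 ∧ IsMixed (oddLabels (2 * k)) σ := by
    intro σ hσ
    rw [mem_kFaces, mem_cyclicBoundary_iff_isPairCovered hm hm5] at hσ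
    obtain ⟨⟨_, hcov⟩, h4⟩ := hσ
    have h1 := card_filter_parity_le (even_two_mul k) hcov 0
    have h2 := card_filter_parity_le (even_two_mul k) hcov 1
    have h3 := Finset.card_filter_add_card_filter_not (s := σ) (· ∈ oddLabels (2 * k))
    have e1 : σ.filter (· ∈ oddLabels (2 * k)) = σ.filter fun s : Fin (2 * k) => (s : ℕ) % 2 = 0 :=
      Finset.filter_congr fun s _ => mem_oddLabels
    have e2 : σ.filter (· ∉ oddLabels (2 * k)) = σ.filter fun s : Fin (2 * k) => (s : ℕ) % 2 = 1 :=
      Finset.filter_congr fun s _ => by rw [mem_oddLabels]; omega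
    rw [isMixed_iff]
    rw [← e1] at h1
    rw [← e2] at h2
    omega
  have hχ := two_mul_eulerChar hM hN hd hV h
  have hF := card_kFaces_four hM hN
  rw [Finset.filter_true_of_mem fun σ hσ => (hquad σ hσ).2] at hχ
  have hq := quadCount_eq_card h hV
  rw [Finset.filter_true_of_mem fun σ hσ => (hquad σ hσ).1] at hq
  rw [hq, hcard.1, hcard.2] at hχ
  rw [hF] at hχ
  have hq' := (congrArg (Nat.cast (R := ℝ)) hq).trans hF
  rw [Fintype.card_fin] at hχ hq'
  push_cast at hχ hq' ⊢
  have hg : genus (cyclicBoundary (2 * k) hm) F x = ((k : ℝ) - 1) * (k - 2) / 2 := by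
    rw [genus]
    linarith
  refine ⟨?_, ?_⟩
  · rw [hg, Nat.cast_choose_two, Nat.cast_sub (by omega)]
    push_cast
    ring
  · rw [hq', hg]
    ring

end NormalSlicing

theorem mainTheorem1 :
    (∀ {V : Type*} [Fintype V] [DecidableEq V] (M : AbstractSimplicialComplex V)
        (V₁ V₂ : Finset V) (F : (V → ℝ) → ℝ) (x c : ℝ),
        IsCombinatorial3Manifold M → IsNeighborly 2 M →
        Disjoint V₁ V₂ → V₁ ∪ V₂ = Finset.univ →
        (V₁.card : ℝ) + c = (V₂.card : ℝ) - c →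
        Defines M V₁ V₂ F x →
        (quadCount M F x : ℝ) ≥
          4 * genus M F x + 3 * (Fintype.card V : ℝ) / 2 - (4 + 2 * c ^ 2)) ∧
    (∀ (k : ℕ) (hk : 3 ≤ k),
        IsCombinatorial3Manifold (cyclicBoundary (2 * k) (by omega)) ∧
        IsNeighborly 2 (cyclicBoundary (2 * k) (by omega)) ∧
        Disjoint (oddLabels (2 * k)) (evenLabels (2 * k)) ∧
        oddLabels (2 * k) ∪ evenLabels (2 * k) = Finset.univ ∧
        (oddLabels (2 * k)).card = (evenLabels (2 * k)).card ∧
        (∃ (F : (Fin (2 * k) → ℝ) → ℝ) (x : ℝ),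
          Defines (cyclicBoundary (2 * k) (by omega)) (oddLabels (2 * k)) (evenLabels (2 * k))
            F x) ∧
        ∀ (F : (Fin (2 * k) → ℝ) → ℝ) (x : ℝ),
          Defines (cyclicBoundary (2 * k) (by omega)) (oddLabels (2 * k)) (evenLabels (2 * k))
            F x →
          genus (cyclicBoundary (2 * k) (by omega)) F x = ((k - 1).choose 2 : ℝ) ∧
          (quadCount (cyclicBoundary (2 * k) (by omega)) F x : ℝ) =
            4 * genus (cyclicBoundary (2 * k) (by omega)) F x + 3 * ((2 * k : ℕ) : ℝ) / 2 - 4) := by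
  refine ⟨fun M V₁ V₂ F x c hM hN hd hV hc h => quadCount_ge hM hN hd hV hc h, fun k hk => ?_⟩
  have hm : 2 ≤ 2 * k := by omega
  have hm5 : 5 ≤ 2 * k := by omega
  exact ⟨isCombinatorial3Manifold_cyclicBoundary hm hm5, isNeighborly_cyclicBoundary hm hm5,
    disjoint_oddLabels_evenLabels _, oddLabels_union_evenLabels _, card_oddLabels k,
    exists_defines_cyclicBoundary hm, fun F x h => genus_and_quadCount_cyclicBoundary hk hm h⟩
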